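/- Let $0<r<1$ be a real number, and let $$\mathbb Z((T))_{>r}=\Big\{\sum_{n\gg-\infty}a_nT^n \;\Big|\; a_n\in\mathbb Z,\ \exists\, r'>r:\ |a_n|(r')^n\to 0 \text{ as } n\to\infty\Big\},$$ a subring of the ring $\mathbb Z((T))$ of Laurent series with finitely many negative exponents. For a prime number $p$ let $\overline{\mathbb Q}_p$ be an algebraic closure of $\mathbb Q_p$, with the absolute value extending that of $\mathbb Q_p$. Then $\mathbb Z((T))_{>r}$ is a principal ideal domain, and its nonzero prime ideals are exactly the following: 1. for any nonzero complex number $x$ with $|x|\le r$, the kernel of the ring homomorphism $\mathbb Z((T))_{>r}\to\mathbb C$, $\sum a_nT^n\mapsto\sum a_nx^n$; 2. for any prime number $p$, the ideal $(p)$; 3. for any prime number $p$ and any topologically nilpotent unit $x\in\overline{\mathbb Q}_p$ (that is, $x\neq 0$ and $x^n\to 0$), the kernel of the ring homomorphism $\mathbb Z((T))_{>r}\to\overline{\mathbb Q}_p$, $\sum a_nT^n\mapsto\sum a_nx^n$. Moreover, two numbers $x,y$ as in (1) have the same kernel if and only if $y=x$ or $y=\overline{x}$. For a fixed prime $p$,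 two elements $x,y$ as in (3) have the same kernel if and only if $y=\sigma(x)$ for some $\sigma\in\mathrm{Gal}(\overline{\mathbb Q}_p/\mathbb Q_p)$; and kernels as in (3) belonging to different primes $p$ are different. -/

import Mathlib

open Filter Topology

namespace ConvergentLaurent

/-- The `n`-th term `a_n x ^ n` of the Laurent series `f = ∑ a_n T ^ n` evaluated at `x`. -/
noncomputable def term {K : Type*} [Field K] (f : LaurentSeries ℤ) (x : K) (n : ℤ) : K :=
  (f.coeff n : K) * x ^ n

/-- The Laurent series `f = ∑ a_n T ^ n` satisfies `|a_n| r' ^ n → 0` for some `r' > r`. -/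
def IsConvergent (r : ℝ) (f : LaurentSeries ℤ) : Prop :=
  ∃ r' : ℝ, r < r' ∧ Tendsto (fun n : ℤ => |(f.coeff n : ℝ)| * r' ^ n) atTop (𝓝 0)

theorem summable_of_shift {f : LaurentSeries ℤ} {u : ℤ → ℝ} (h0 : ∀ n, f.coeff n = 0 → u n = 0)
    (h : Summable fun k : ℕ => u (f.order + k)) : Summable u := by
  have hi : Function.Injective (fun k : ℕ => f.order + (k : ℤ)) := by
    intro a b hab
    simpa using hab
  refine (hi.summable_iff ?_).1 h
  intro n hn
  refine h0 n (HahnSeries.coeff_eq_zero_of_lt_order ?_)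
  by_contra hlt
  exact hn ⟨(n - f.order).toNat, by simp only; omega⟩

theorem summable_of_tendsto {f : LaurentSeries ℤ} {ρ s : ℝ} (hρ : 0 < ρ) (hs : ρ < s)
    (h : Tendsto (fun n : ℤ => |(f.coeff n : ℝ)| * s ^ n) atTop (𝓝 0)) :
    Summable fun n : ℤ => |(f.coeff n : ℝ)| * ρ ^ n := by
  have hs0 : 0 < s := hρ.trans hs
  refine summable_of_shift (f := f) (fun n hn => by simp [hn]) ?_
  have ht : Tendsto (fun k : ℕ => f.order + (k : ℤ)) atTop atTop :=
    tendsto_atTop_add_const_left _ _ tendsto_natCast_atTop_atTop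
  obtain ⟨C, hC⟩ := (h.comp ht).bddAbove_range
  have hq : Summable fun k : ℕ => C * (ρ / s) ^ f.order * (ρ / s) ^ k :=
    (summable_geometric_of_lt_one (by positivity) ((div_lt_one hs0).2 hs)).mul_left _
  refine Summable.of_nonneg_of_le (fun k => by positivity) (fun k => ?_) hq
  have h1 : |(f.coeff (f.order + k) : ℝ)| * s ^ (f.order + (k : ℤ)) ≤ C := hC ⟨k, rfl⟩
  have h2 : ρ ^ (f.order + (k : ℤ)) = s ^ (f.order + (k : ℤ)) * ((ρ / s) ^ f.order * (ρ / s) ^ k) := by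
    rw [← zpow_natCast (ρ / s) k, ← zpow_add₀ (by positivity), div_zpow]
    field_simp
  rw [h2, ← mul_assoc, mul_assoc C]
  exact mul_le_mul_of_nonneg_right h1 (by positivity)

/-- The coefficients of a product, as sums over all of `ℤ`. -/
theorem hasSum_term_mul {K : Type*} [Field K] [TopologicalSpace K] (f g : LaurentSeries ℤ) {x : K}
    (hx : x ≠ 0) (n : ℤ) :
    HasSum (fun i : ℤ => term f x i * term g x (n - i)) (term (f * g) x n) := by
  classical
  let A := Finset.antidiagonal f.isPWO_support g.isPWO_support n
  have hinj : Set.InjOn Prod.fst (A : Set (ℤ × ℤ)) := by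
    intro a ha b hb hab
    have ha' := (Finset.mem_antidiagonal.1 (Finset.mem_coe.1 ha)).2.2
    have hb' := (Finset.mem_antidiagonal.1 (Finset.mem_coe.1 hb)).2.2
    exact Prod.ext hab (by omega)
  have hmul : term (f * g) x n = ∑ i ∈ A.image Prod.fst, term f x i * term g x (n - i) := by
    rw [Finset.sum_image hinj, term, HahnSeries.coeff_mul, Int.cast_sum, Finset.sum_mul]
    refine Finset.sum_congr rfl fun a ha => ?_
    have ha' := (Finset.mem_antidiagonal.1 ha).2.2
    have hz : n - a.1 = a.2 := by omega
    rw [hz, ← ha', zpow_add₀ hx, term, term]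
    push_cast
    ring
  rw [hmul]
  refine hasSum_sum_of_ne_finset_zero fun i hi => ?_
  by_contra hne
  refine hi (Finset.mem_image.2 ⟨(i, n - i), ?_, rfl⟩)
  refine Finset.mem_antidiagonal.2 ⟨?_, ?_, by simp⟩
  · exact fun h => hne (by simp [term, h])
  · exact fun h => hne (by simp [term, h])

def shear : ℤ × ℤ ≃ ℤ × ℤ where
  toFun q := (q.2, q.1 - q.2)
  invFun q := (q.1 + q.2, q.1)
  left_inv q := by simp
  right_inv q := by simp

theorem hasSum_mul {K : Type*} [NormedField K] [CompleteSpace K] {f g : LaurentSeries ℤ} {x : K}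
    (hx : x ≠ 0) (hf : Summable fun n => ‖term f x n‖) (hg : Summable fun n => ‖term g x n‖) :
    HasSum (term (f * g) x) ((∑' n, term f x n) * ∑' n, term g x n) := by
  have h := (hf.of_norm.hasSum.mul hg.of_norm.hasSum (summable_mul_of_summable_norm hf hg))
  exact ((Equiv.hasSum_iff shear).2 h).prod_fiberwise fun n => hasSum_term_mul f g hx n

theorem summable_norm_mul {K : Type*} [NormedField K] [CompleteSpace K] {f g : LaurentSeries ℤ}
    {x : K} (hx : x ≠ 0) (hf : Summable fun n => ‖term f x n‖)
    (hg : Summable fun n => ‖term g x n‖) : Summable fun n => ‖term (f * g) x n‖ := by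
  have h : Summable fun q : ℤ × ℤ => ‖term f x q.1 * term g x q.2‖ := hf.mul_norm hg
  have h' := (Equiv.summable_iff shear).2 h
  refine Summable.of_nonneg_of_le (fun n => norm_nonneg _) (fun n => ?_) h'.prod
  rw [← (hasSum_term_mul f g hx n).tsum_eq]
  exact norm_tsum_le_tsum_norm (h'.prod_factor n)

theorem isConvergent_of_neg {r : ℝ} (hr : r < 0) (f : LaurentSeries ℤ) : IsConvergent r f := by
  refine ⟨0, hr, tendsto_const_nhds.congr' ?_⟩
  filter_upwards [eventually_gt_atTop 0] with n hn
  simp [zero_zpow n hn.ne']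

theorem norm_term_real (f : LaurentSeries ℤ) {ρ : ℝ} (hρ : 0 < ρ) (n : ℤ) :
    ‖term f ρ n‖ = |(f.coeff n : ℝ)| * ρ ^ n := by
  rw [term, norm_mul, Real.norm_eq_abs, Real.norm_eq_abs, abs_of_pos (zpow_pos hρ n)]

theorem IsConvergent.exists_summable {r : ℝ} (hr : 0 ≤ r) {f g : LaurentSeries ℤ}
    (hf : IsConvergent r f) (hg : IsConvergent r g) : ∃ ρ : ℝ, r < ρ ∧
      Summable (fun n => ‖term f ρ n‖) ∧ Summable (fun n => ‖term g ρ n‖) := by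
  obtain ⟨s, hs, hs'⟩ := hf
  obtain ⟨t, ht, ht'⟩ := hg
  obtain ⟨ρ, h1, h2⟩ := exists_between (lt_min hs ht)
  have hρ : 0 < ρ := hr.trans_lt h1
  refine ⟨ρ, h1, ?_, ?_⟩
  · simpa only [norm_term_real _ hρ] using
      summable_of_tendsto hρ (h2.trans_le (min_le_left _ _)) hs'
  · simpa only [norm_term_real _ hρ] using
      summable_of_tendsto hρ (h2.trans_le (min_le_right _ _)) ht'

theorem isConvergent_of_summable {r ρ : ℝ} (hr : 0 ≤ r) (h : r < ρ) {f : LaurentSeries ℤ}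
    (hf : Summable fun n => ‖term f ρ n‖) : IsConvergent r f := by
  refine ⟨ρ, h, ?_⟩
  simp only [norm_term_real f (hr.trans_lt h)] at hf
  exact hf.tendsto_cofinite_zero.mono_left (Int.cofinite_eq ▸ le_sup_right)

theorem isConvergent_single_zero (r : ℝ) (a : ℤ) :
    IsConvergent r (HahnSeries.single 0 a : LaurentSeries ℤ) := by
  refine ⟨r + 1, by linarith, tendsto_const_nhds.congr' ?_⟩
  filter_upwards [eventually_gt_atTop 0] with n hn
  simp [HahnSeries.coeff_single_of_ne hn.ne']

theorem term_zero {K : Type*} [Field K] (x : K) (n : ℤ) : term 0 x n = 0 := by simp [term]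

theorem term_add {K : Type*} [Field K] (f g : LaurentSeries ℤ) (x : K) (n : ℤ) :
    term (f + g) x n = term f x n + term g x n := by simp [term, add_mul]

theorem term_neg {K : Type*} [Field K] (f : LaurentSeries ℤ) (x : K) (n : ℤ) :
    term (-f) x n = -term f x n := by simp [term]

theorem hasSum_one {K : Type*} [Field K] [TopologicalSpace K] (x : K) :
    HasSum (term (1 : LaurentSeries ℤ) x) 1 := by
  have h := hasSum_single (f := term (1 : LaurentSeries ℤ) x) 0 fun n hn => by
    simp [term, HahnSeries.coeff_one, hn]
  simpa [term, HahnSeries.coeff_one] using h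

end ConvergentLaurent

open ConvergentLaurent

/-- The ring `ℤ((T))_{>r}` of Laurent series `∑ a_n T ^ n` with integer coefficients (finitely many
negative exponents) such that `|a_n| r' ^ n → 0` as `n → ∞` for some `r' > r`. -/
def convergentLaurent (r : ℝ) : Subring (LaurentSeries ℤ) where
  carrier := {f | ∃ r' : ℝ, r < r' ∧ Tendsto (fun n : ℤ => |(f.coeff n : ℝ)| * r' ^ n) atTop (𝓝 0)}
  zero_mem' := by
    have h := isConvergent_single_zero r 0
    rwa [HahnSeries.single_eq_zero] at h
  one_mem' := isConvergent_single_zero r 1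
  neg_mem' := by
    rintro f ⟨s, hs, h⟩
    exact ⟨s, hs, by simpa using h⟩
  add_mem' := by
    intro f g hf hg
    rcases lt_or_ge r 0 with hr | hr
    · exact isConvergent_of_neg hr _
    obtain ⟨ρ, hρ, h1, h2⟩ := IsConvergent.exists_summable hr hf hg
    refine isConvergent_of_summable hr hρ ?_
    refine Summable.of_nonneg_of_le (fun n => norm_nonneg _) (fun n => ?_) (h1.add h2)
    rw [term_add]
    exact norm_add_le _ _
  mul_mem' := by
    intro f g hf hg
    rcases lt_or_ge r 0 with hr | hr
    · exact isConvergent_of_neg hr _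
    obtain ⟨ρ, hρ, h1, h2⟩ := IsConvergent.exists_summable hr hf hg
    exact isConvergent_of_summable hr hρ (summable_norm_mul (hr.trans_lt hρ).ne' h1 h2)

namespace ConvergentLaurent

theorem summable_complex {r : ℝ} {x : ℂ} (hx : x ≠ 0) (hxr : ‖x‖ ≤ r) (f : convergentLaurent r) :
    Summable fun n => ‖term (f : LaurentSeries ℤ) x n‖ := by
  obtain ⟨s, hs, h⟩ := f.2
  have h' := summable_of_tendsto (norm_pos_iff.2 hx) (hxr.trans_lt hs) h
  refine h'.congr fun n => ?_
  rw [term, norm_mul, norm_zpow, Complex.norm_intCast]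

/-- The ring homomorphism `ℤ((T))_{>r} → ℂ`, `∑ a_n T ^ n ↦ ∑ a_n x ^ n`, for `0 < |x| ≤ r`;
the sum converges absolutely. -/
noncomputable def evalComplex {r : ℝ} (x : ℂ) (hx : x ≠ 0) (hxr : ‖x‖ ≤ r) :
    convergentLaurent r →+* ℂ where
  toFun f := ∑' n : ℤ, ((f : LaurentSeries ℤ).coeff n : ℂ) * x ^ n
  map_zero' := by simp
  map_one' := (hasSum_one x).tsum_eq
  map_add' f g := by
    have h := (summable_complex hx hxr f).of_norm.tsum_add (summable_complex hx hxr g).of_norm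
    rw [← tsum_congr fun n => term_add (f : LaurentSeries ℤ) g x n] at h
    exact h
  map_mul' f g := (hasSum_mul hx (summable_complex hx hxr f) (summable_complex hx hxr g)).tsum_eq

theorem hasSum_evalComplex {r : ℝ} (x : ℂ) (hx : x ≠ 0) (hxr : ‖x‖ ≤ r)
    (f : convergentLaurent r) :
    HasSum (fun n : ℤ => ((f : LaurentSeries ℤ).coeff n : ℂ) * x ^ n) (evalComplex x hx hxr f) :=
  (summable_complex hx hxr f).of_norm.hasSum

section Padic

variable {p : ℕ} [Fact p.Prime]

theorem norm_lt_one_of_isTopologicallyNilpotent {x : PadicAlgCl p}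
    (h : IsTopologicallyNilpotent x) : ‖x‖ < 1 := by
  have h' : Tendsto (fun n : ℕ => ‖x‖ ^ n) atTop (𝓝 0) := by
    simpa using (show Tendsto (fun n : ℕ => x ^ n) atTop (𝓝 0) from h).norm
  simpa using tendsto_pow_atTop_nhds_zero_iff.1 h'

theorem norm_intCast_le_one_padicAlgCl (a : ℤ) : ‖(a : PadicAlgCl p)‖ ≤ 1 := by
  rw [← map_intCast (algebraMap ℚ_[p] (PadicAlgCl p))]
  exact (PadicAlgCl.norm_extends p a).trans_le (Padic.norm_int_le_one a)

theorem summable_padic {x : PadicAlgCl p} (hx : x ≠ 0) (h : IsTopologicallyNilpotent x)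
    (f : LaurentSeries ℤ) : Summable fun n => ‖term f x n‖ := by
  have hx0 := norm_pos_iff.2 hx
  refine summable_of_shift (f := f) (fun n hn => by simp [term, hn]) ?_
  refine Summable.of_nonneg_of_le (fun n => norm_nonneg _) (fun k => ?_)
    ((summable_geometric_of_lt_one hx0.le
      (norm_lt_one_of_isTopologicallyNilpotent h)).mul_left (‖x‖ ^ f.order))
  rw [term, norm_mul, norm_zpow, zpow_add₀ hx0.ne', zpow_natCast]
  exact mul_le_of_le_one_left (by positivity) (norm_intCast_le_one_padicAlgCl _)

/-- `ℚ_p(x)` is complete, as a finite extension of `ℚ_p`. -/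
theorem completeSpace_adjoin (x : PadicAlgCl p) :
    CompleteSpace (IntermediateField.adjoin ℚ_[p] {x}) := by
  have : FiniteDimensional ℚ_[p] (IntermediateField.adjoin ℚ_[p] {x}) :=
    IntermediateField.adjoin.finiteDimensional (Algebra.IsIntegral.isIntegral x)
  exact FiniteDimensional.complete ℚ_[p] _

theorem coe_term (x : PadicAlgCl p) (f : LaurentSeries ℤ) (n : ℤ) :
    ((term f (IntermediateField.AdjoinSimple.gen ℚ_[p] x) n :
      IntermediateField.adjoin ℚ_[p] {x}) : PadicAlgCl p) = term f x n := by
  have h : algebraMap (IntermediateField.adjoin ℚ_[p] {x}) (PadicAlgCl p)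
      (term f (IntermediateField.AdjoinSimple.gen ℚ_[p] x) n) = term f x n := by
    rw [term, map_mul, map_zpow₀, map_intCast, IntermediateField.AdjoinSimple.algebraMap_gen, term]
  exact h

theorem hasSum_padic {x : PadicAlgCl p} (hx : x ≠ 0) (h : IsTopologicallyNilpotent x)
    (f : LaurentSeries ℤ) :
    HasSum (term f x)
      ((∑' n, term f (IntermediateField.AdjoinSimple.gen ℚ_[p] x) n :
        IntermediateField.adjoin ℚ_[p] {x}) : PadicAlgCl p) := by
  have := completeSpace_adjoin x
  have hs : Summable fun n => ‖term f (IntermediateField.AdjoinSimple.gen ℚ_[p] x) n‖ :=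
    (summable_padic hx h f).congr fun n => by rw [← coe_term]; rfl
  have h2 := hs.of_norm.hasSum.map
    (algebraMap (IntermediateField.adjoin ℚ_[p] {x}) (PadicAlgCl p)) continuous_subtype_val
  exact h2.congr_fun fun n => (coe_term x f n).symm

theorem hasSum_padic_mul {x : PadicAlgCl p} (hx : x ≠ 0) (h : IsTopologicallyNilpotent x)
    (f g : LaurentSeries ℤ) :
    HasSum (term (f * g) x) ((∑' n, term f x n) * ∑' n, term g x n) := by
  have := completeSpace_adjoin x
  have hs (f : LaurentSeries ℤ) :
      Summable fun n => ‖term f (IntermediateField.AdjoinSimple.gen ℚ_[p] x) n‖ :=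
    (summable_padic hx h f).congr fun n => by rw [← coe_term]; rfl
  have hx' : IntermediateField.AdjoinSimple.gen ℚ_[p] x ≠ 0 := fun h0 => hx (by
    simpa using congrArg (algebraMap _ (PadicAlgCl p)) h0)
  have h2 := hasSum_padic hx h (f * g)
  rw [(hasSum_mul hx' (hs f) (hs g)).tsum_eq] at h2
  rw [(hasSum_padic hx h f).tsum_eq, (hasSum_padic hx h g).tsum_eq]
  exact h2

/-- The ring homomorphism `ℤ((T))_{>r} → ℚ̄_p`, `∑ a_n T ^ n ↦ ∑ a_n x ^ n`, for a topologically
nilpotent unit `x` of `ℚ̄_p`; the sum converges in `ℚ_p(x)`. -/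
noncomputable def evalPadic {r : ℝ} (x : PadicAlgCl p) (hx : x ≠ 0)
    (h : IsTopologicallyNilpotent x) : convergentLaurent r →+* PadicAlgCl p where
  toFun f := ∑' n : ℤ, ((f : LaurentSeries ℤ).coeff n : PadicAlgCl p) * x ^ n
  map_zero' := by simp
  map_one' := (hasSum_one x).tsum_eq
  map_add' f g := by
    have h := (hasSum_padic hx h f).summable.tsum_add (hasSum_padic hx h g).summable
    rw [← tsum_congr fun n => term_add (f : LaurentSeries ℤ) g x n] at h
    exact h
  map_mul' f g := (hasSum_padic_mul hx h (f : LaurentSeries ℤ) g).tsum_eq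

theorem hasSum_evalPadic {r : ℝ} (x : PadicAlgCl p) (hx : x ≠ 0)
    (h : IsTopologicallyNilpotent x) (f : convergentLaurent r) :
    HasSum (fun n : ℤ => ((f : LaurentSeries ℤ).coeff n : PadicAlgCl p) * x ^ n)
      (evalPadic x hx h f) :=
  (hasSum_padic hx h (f : LaurentSeries ℤ)).summable.hasSum

end Padic

end ConvergentLaurent

namespace ConvergentLaurent

/-! Up to a power of the unit `T`, a nonzero element is an integral power series `F` with `F(0) ≠
0`, holomorphic on a disc slightly larger than `|z| ≤ r`. If `F = G * H` in `ℤ⟦T⟧` with `F` and `G`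
in the ring, then `H` is in the ring as soon as `F / G` is holomorphic near the closed disc.
Divisibility thus splits into an arithmetic and an analytic question.

Complex points: `F` has finitely many zeros in the closed disc. For such a zero `x`, take a real
polynomial `Q` with `Q(0) = 1` and simple zeros exactly at `x` and its conjugate. Multiply it by `∏
(1 + c_k T^(k+1))`, where the `c_k ∈ [0, 1)` round the coefficients up to integers one after
another. The product has no zeros for `|z| < 1`. The result `G` has constant coefficient `1`, so it
is invertible in `ℤ⟦T⟧` and divides every element vanishing at `x`. Removing all zeros leaves a
zero-free factor (`exists_prod_mul_zeroFree`), and division by a zero-free series is a question in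
`ℤ⟦T⟧` alone.

`p`-adic points: a zero-free `F` is treated by induction on `|F(0)|`. If this is `1`, then `F` is a
unit. Otherwise some prime `p` divides `F(0)`. Either `p` divides `F`, or Weierstrass preparation
over `ℤ_p` gives a root `x ≠ 0` with `‖x‖ < 1`. The minimal polynomial of `x` is distinguished, and
it is turned into a zero-free integral generator `G` of the kernel at `x` with `G(0) = p^k`, `k ≠ 0`
(`exists_generator_padic`). Both divisions lower `|F(0)|`.

Hence every nonzero prime contains a generator of a listed ideal. Listed ideals are maximal: the
image of an evaluation contains `ℝ` or `ℚ_p`, and modulo `p` a nonzero series is a power of `T`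
times a unit. So the prime is the listed ideal, and principal nonzero primes give a principal ideal
ring. Kernels are compared by evaluating a generator of one at the other point. -/

/-- The power series `F` converges to `φ` on the open disc of radius `ρ` about `0`. -/
def HasExpansion (φ : ℂ → ℂ) (F : PowerSeries ℂ) (ρ : ℝ) : Prop :=
  ∀ z : ℂ, ‖z‖ < ρ → HasSum (fun n : ℕ => PowerSeries.coeff n F * z ^ n) (φ z)

/-! ### Holomorphic functions on a disc and their expansions -/

namespace HasExpansion

variable {φ ψ : ℂ → ℂ} {F G : PowerSeries ℂ} {ρ σ : ℝ}

theorem mono (h : HasExpansion φ F ρ) (hσ : σ ≤ ρ) : HasExpansion φ F σ :=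
  fun z hz => h z (hz.trans_le hσ)

theorem congr (h : HasExpansion φ F ρ) (hφ : ∀ z, ‖z‖ < ρ → φ z = ψ z) : HasExpansion ψ F ρ :=
  fun z hz => hφ z hz ▸ h z hz

theorem tsum_eq (h : HasExpansion φ F ρ) {z : ℂ} (hz : ‖z‖ < ρ) :
    ∑' n : ℕ, PowerSeries.coeff n F * z ^ n = φ z :=
  (h z hz).tsum_eq

theorem mul (hF : HasExpansion φ F ρ) (hG : HasExpansion ψ G ρ) :
    HasExpansion (φ * ψ) (F * G) ρ := by
  intro z hz
  have h1 := (hF z hz).summable.norm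
  have h2 := (hG z hz).summable.norm
  have h3 := tsum_mul_tsum_eq_tsum_sum_antidiagonal_of_summable_norm h1 h2
  have h4 := (summable_norm_sum_mul_antidiagonal_of_summable_norm h1 h2).of_norm.hasSum
  rw [← h3, (hF z hz).tsum_eq, (hG z hz).tsum_eq] at h4
  refine h4.congr_fun fun n => ?_
  rw [PowerSeries.coeff_mul, Finset.sum_mul]
  refine Finset.sum_congr rfl fun q hq => ?_
  rw [← Finset.HasAntidiagonal.mem_antidiagonal.1 hq, pow_add]
  ring

theorem coe_polynomial (P : Polynomial ℂ) (ρ : ℝ) :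
    HasExpansion (fun z => P.eval z) (P : PowerSeries ℂ) ρ := by
  intro z _
  beta_reduce
  rw [Polynomial.eval_eq_sum_range]
  simp only [Polynomial.coeff_coe]
  refine hasSum_sum_of_ne_finset_zero fun n hn => ?_
  rw [Polynomial.coeff_eq_zero_of_natDegree_lt (by simpa using hn), zero_mul]

theorem hasFPowerSeriesOnBall (h : HasExpansion φ F ρ) (hρ : 0 < ρ) :
    HasFPowerSeriesOnBall φ
      (FormalMultilinearSeries.ofScalars ℂ fun n => PowerSeries.coeff n F) 0 (ENNReal.ofReal ρ) where
  r_le := by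
    refine le_of_forall_lt_imp_le_of_dense fun a ha => ?_
    lift a to NNReal using ha.ne_top
    have ha' : (a : ℝ) < ρ := by
      rwa [ENNReal.coe_nnreal_eq, ENNReal.ofReal_lt_ofReal_iff hρ] at ha
    refine FormalMultilinearSeries.le_radius_of_summable _ ?_
    have h1 := (h ((a : ℝ) : ℂ) (by simpa using ha')).summable.norm
    refine h1.congr fun n => ?_
    simp
  r_pos := by simpa using hρ
  hasSum := by
    intro y hy
    have hy' : ‖y‖ < ρ := by
      rw [Metric.eball_ofReal] at hy
      simpa using hy
    simpa [FormalMultilinearSeries.ofScalars_apply_eq, mul_comm] using h y hy'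

theorem differentiableOn (h : HasExpansion φ F ρ) (hρ : 0 < ρ) :
    DifferentiableOn ℂ φ (Metric.ball 0 ρ) := by
  have := (h.hasFPowerSeriesOnBall hρ).differentiableOn
  rwa [Metric.eball_ofReal] at this

theorem analyticAt (h : HasExpansion φ F ρ) {z : ℂ} (hz : ‖z‖ < ρ) : AnalyticAt ℂ φ z :=
  (h.differentiableOn ((norm_nonneg z).trans_lt hz)).analyticAt
    (Metric.isOpen_ball.mem_nhds (by simpa using hz))

theorem unique (hF : HasExpansion φ F ρ) (hG : HasExpansion φ G ρ) (hρ : 0 < ρ) : F = G := by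
  have h := (hF.hasFPowerSeriesOnBall hρ).hasFPowerSeriesAt.eq_formalMultilinearSeries
    (hG.hasFPowerSeriesOnBall hρ).hasFPowerSeriesAt
  have h' := FormalMultilinearSeries.ofScalars_series_injective ℂ ℂ h
  ext n
  exact congrFun h' n

theorem taylor (h : DifferentiableOn ℂ φ (Metric.ball 0 ρ)) :
    HasExpansion φ (PowerSeries.mk fun n => (n.factorial : ℂ)⁻¹ * iteratedDeriv n φ 0) ρ := by
  intro z hz
  have h1 := Complex.hasSum_taylorSeries_on_ball (r := ρ) h (z := z) (by simpa using hz)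
  refine h1.congr_fun fun n => ?_
  simp only [PowerSeries.coeff_mk, sub_zero, smul_eq_mul]
  ring

/-- By uniqueness of expansions the Taylor series of `η`, multiplied by `G`, is `F`; cancelling `G`
identifies it with the formal quotient `H`. -/
theorem of_mul_eq (hF : HasExpansion φ F ρ) (hG : HasExpansion ψ G ρ) (hρ : 0 < ρ) (hG0 : G ≠ 0)
    {η : ℂ → ℂ} (hη : DifferentiableOn ℂ η (Metric.ball 0 ρ))
    (h : ∀ z, ‖z‖ < ρ → φ z = ψ z * η z) {H : PowerSeries ℂ} (hH : F = G * H) :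
    HasExpansion η H ρ := by
  have h1 := taylor hη
  have h2 := (hG.mul h1).unique ((hF.congr h)) hρ
  rw [hH] at h2
  rwa [mul_left_cancel₀ hG0 h2] at h1

end HasExpansion

/-! ### Integral power series in the ring -/

/-- Integral power series as complex power series. -/
noncomputable def toComplex : PowerSeries ℤ →+* PowerSeries ℂ :=
  PowerSeries.map (Int.castRingHom ℂ)

@[simp]
theorem coeff_toComplex (F : PowerSeries ℤ) (n : ℕ) :
    PowerSeries.coeff n (toComplex F) = ((PowerSeries.coeff n F : ℤ) : ℂ) := by
  simp [toComplex]

theorem toComplex_injective : Function.Injective toComplex := by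
  intro F G h
  ext n
  have := congrArg (PowerSeries.coeff n) h
  simpa using this

/-- The integral power series in `ℤ((T))_{>r}`. -/
noncomputable def convPS (r : ℝ) : Subring (PowerSeries ℤ) :=
  (convergentLaurent r).comap (HahnSeries.ofPowerSeries ℤ ℤ)

/-- The inclusion of the power series in `ℤ((T))_{>r}`. -/
noncomputable def ofPS (r : ℝ) : convPS r →+* convergentLaurent r :=
  ((HahnSeries.ofPowerSeries ℤ ℤ).comp (convPS r).subtype).codRestrict _ fun F => F.2

theorem coe_ofPS {r : ℝ} (F : convPS r) :
    (ofPS r F : LaurentSeries ℤ) = HahnSeries.ofPowerSeries ℤ ℤ (F : PowerSeries ℤ) := rfl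

theorem ofPS_injective (r : ℝ) : Function.Injective (ofPS r) := by
  intro F G h
  exact Subtype.ext (HahnSeries.ofPowerSeries_injective (congrArg Subtype.val h))

theorem coeff_ofPowerSeries_natCast (F : PowerSeries ℤ) (n : ℕ) :
    (HahnSeries.ofPowerSeries ℤ ℤ F).coeff (n : ℤ) = PowerSeries.coeff n F :=
  LaurentSeries.coeff_coe_powerSeries F n

theorem coeff_ofPowerSeries_of_neg (F : PowerSeries ℤ) {n : ℤ} (hn : n < 0) :
    (HahnSeries.ofPowerSeries ℤ ℤ F).coeff n = 0 := by
  have := PowerSeries.coeff_coe F n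
  rwa [if_pos hn] at this

theorem hasSum_ofPowerSeries {K : Type*} [Field K] [TopologicalSpace K] (F : PowerSeries ℤ) (x a : K) :
    HasSum (term (HahnSeries.ofPowerSeries ℤ ℤ F) x) a ↔
      HasSum (fun n : ℕ => ((PowerSeries.coeff n F : ℤ) : K) * x ^ n) a := by
  rw [← (Nat.cast_injective (R := ℤ)).hasSum_iff]
  · refine iff_of_eq (congrArg (HasSum · a) (funext fun n => ?_))
    rw [Function.comp, term, coeff_ofPowerSeries_natCast, zpow_natCast]
  · intro n hn
    rw [term, coeff_ofPowerSeries_of_neg, Int.cast_zero, zero_mul]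
    by_contra h
    exact hn ⟨n.toNat, by omega⟩

/-- Membership becomes holomorphy on a disc of radius larger than `r`; the radius in the definition
is shrunk slightly to pass between terms tending to zero and absolute convergence. -/
theorem mem_convPS_iff {r : ℝ} (hr : 0 ≤ r) {F : PowerSeries ℤ} :
    F ∈ convPS r ↔ ∃ φ ρ, r < ρ ∧ HasExpansion φ (toComplex F) ρ := by
  constructor
  · intro h
    obtain ⟨ρ, hρ, h1, -⟩ := IsConvergent.exists_summable hr (f := HahnSeries.ofPowerSeries ℤ ℤ F)
      (g := 0) h (convergentLaurent r).zero_mem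
    have hρ0 := hr.trans_lt hρ
    obtain ⟨a, ha⟩ := h1
    refine ⟨fun z => ∑' n : ℕ, PowerSeries.coeff n (toComplex F) * z ^ n, ρ, hρ, fun z hz => ?_⟩
    refine Summable.hasSum (Summable.of_norm ?_)
    have h3 := ha.summable.comp_injective (Nat.cast_injective (R := ℤ))
    refine Summable.of_nonneg_of_le (fun n => norm_nonneg _) (fun n => ?_) h3
    rw [Function.comp, norm_term_real _ hρ0, coeff_ofPowerSeries_natCast, norm_mul, norm_pow,
      coeff_toComplex, Complex.norm_intCast, zpow_natCast]
    gcongr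
  · rintro ⟨φ, ρ, hρ, h⟩
    obtain ⟨s, hs, hs'⟩ := exists_between hρ
    have hs0 := hr.trans_lt hs
    have h1 := (h ((s : ℝ) : ℂ) (by simpa [abs_of_pos hs0] using hs')).summable.norm
    refine isConvergent_of_summable hr hs ?_
    refine ((Nat.cast_injective (R := ℤ)).summable_iff ?_).1 (h1.congr fun n => ?_)
    · intro n hn
      rw [term, coeff_ofPowerSeries_of_neg, Int.cast_zero, zero_mul, norm_zero]
      by_contra h
      exact hn ⟨n.toNat, by omega⟩
    · rw [Function.comp, norm_term_real _ hs0, coeff_ofPowerSeries_natCast]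
      simp [abs_of_pos hs0]

theorem hasExpansion_one_of_bounded {F : PowerSeries ℂ} {C : ℝ}
    (h : ∀ n, ‖PowerSeries.coeff n F‖ ≤ C) :
    HasExpansion (fun z => ∑' n : ℕ, PowerSeries.coeff n F * z ^ n) F 1 := by
  intro z hz
  refine Summable.hasSum (Summable.of_norm ?_)
  refine Summable.of_nonneg_of_le (fun n => norm_nonneg _) (fun n => ?_)
    ((summable_geometric_of_lt_one (norm_nonneg z) hz).mul_left C)
  rw [norm_mul, norm_pow]
  exact mul_le_mul_of_nonneg_right (h n) (by positivity)

/-- This is where `r < 1` enters: series built by rounding to bounded integers converge on the whole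
unit disc. -/
theorem mem_convPS_of_bounded {r : ℝ} (hr : 0 ≤ r) (hr1 : r < 1) {F : PowerSeries ℤ} {C : ℝ}
    (h : ∀ n, |((PowerSeries.coeff n F : ℤ) : ℝ)| ≤ C) : F ∈ convPS r := by
  refine (mem_convPS_iff hr).2 ⟨_, 1, hr1, hasExpansion_one_of_bounded (C := C) fun n => ?_⟩
  rw [coeff_toComplex, Complex.norm_intCast]
  exact h n

/-- The sum of a power series in `ℤ((T))_{>r}` at a complex number. -/
noncomputable def sumAt {r : ℝ} (F : convPS r) (z : ℂ) : ℂ :=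
  ∑' n : ℕ, PowerSeries.coeff n (toComplex F) * z ^ n

theorem exists_hasExpansion {r : ℝ} (hr : 0 ≤ r) (F : convPS r) :
    ∃ ρ, r < ρ ∧ HasExpansion (sumAt F) (toComplex F) ρ := by
  obtain ⟨φ, ρ, hρ, h⟩ := (mem_convPS_iff hr).1 F.2
  exact ⟨ρ, hρ, h.congr fun z hz => (h.tsum_eq hz).symm⟩

theorem evalComplex_ofPS {r : ℝ} {x : ℂ} (hx : x ≠ 0) (hxr : ‖x‖ ≤ r) (F : convPS r) :
    evalComplex x hx hxr (ofPS r F) = sumAt F x := by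
  have h := (hasSum_ofPowerSeries (F : PowerSeries ℤ) x _).1 (hasSum_evalComplex x hx hxr (ofPS r F))
  rw [← h.tsum_eq, sumAt]
  simp

theorem evalPadic_ofPS {r : ℝ} {p : ℕ} [Fact p.Prime] {x : PadicAlgCl p} (hx : x ≠ 0)
    (hn : IsTopologicallyNilpotent x) (F : convPS r) :
    HasSum (fun n : ℕ => ((PowerSeries.coeff n (F : PowerSeries ℤ) : ℤ) : PadicAlgCl p) * x ^ n)
      (evalPadic x hx hn (ofPS r F)) :=
  (hasSum_ofPowerSeries (F : PowerSeries ℤ) x _).1 (hasSum_evalPadic x hx hn (ofPS r F))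

theorem isConvergent_single (r : ℝ) (m : ℤ) (a : ℤ) :
    IsConvergent r (HahnSeries.single m a : LaurentSeries ℤ) := by
  refine ⟨r + 1, by linarith, tendsto_const_nhds.congr' ?_⟩
  filter_upwards [eventually_gt_atTop m] with n hn
  simp [HahnSeries.coeff_single_of_ne hn.ne']

/-- The powers of the unit `T` of `ℤ((T))_{>r}`. -/
noncomputable def unitT (r : ℝ) (m : ℤ) : (convergentLaurent r)ˣ where
  val := ⟨HahnSeries.single m 1, isConvergent_single r m 1⟩
  inv := ⟨HahnSeries.single (-m) 1, isConvergent_single r (-m) 1⟩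
  val_inv := Subtype.ext (by simp)
  inv_val := Subtype.ext (by simp)

theorem exists_eq_unitT_mul {r : ℝ} {f : convergentLaurent r} (hf : f ≠ 0) :
    ∃ (m : ℤ) (F : convPS r), PowerSeries.coeff 0 (F : PowerSeries ℤ) ≠ 0 ∧
      f = unitT r m * ofPS r F := by
  have h1 : ((unitT r (-(f : LaurentSeries ℤ).order) : convergentLaurent r) : LaurentSeries ℤ) * f
      = HahnSeries.ofPowerSeries ℤ ℤ (LaurentSeries.powerSeriesPart (f : LaurentSeries ℤ)) :=
    (LaurentSeries.ofPowerSeries_powerSeriesPart (f : LaurentSeries ℤ)).symm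
  refine ⟨(f : LaurentSeries ℤ).order, ⟨LaurentSeries.powerSeriesPart (f : LaurentSeries ℤ), ?_⟩,
    ?_, ?_⟩
  · change HahnSeries.ofPowerSeries ℤ ℤ _ ∈ convergentLaurent r
    rw [← h1]
    exact (convergentLaurent r).mul_mem (unitT r _ : convergentLaurent r).2 f.2
  · rw [LaurentSeries.powerSeriesPart_coeff]
    simpa using fun h => hf (Subtype.ext h)
  · apply Subtype.ext
    rw [Subring.coe_mul, coe_ofPS]
    exact (LaurentSeries.single_order_mul_powerSeriesPart (f : LaurentSeries ℤ)).symm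

end ConvergentLaurent

theorem TendstoLocallyUniformlyOn.iteratedDeriv_complex {ι : Type*} {l : Filter ι} {U : Set ℂ}
    (hU : IsOpen U) (n : ℕ) {F : ι → ℂ → ℂ} {f : ℂ → ℂ} (hf : TendstoLocallyUniformlyOn F f l U)
    (hF : ∀ i, DifferentiableOn ℂ (F i) U) :
    TendstoLocallyUniformlyOn (fun i => iteratedDeriv n (F i)) (iteratedDeriv n f) l U := by
  induction n generalizing F f with
  | zero => simpa using hf
  | succ n ih =>
    simp only [iteratedDeriv_succ']
    exact ih (hf.deriv (.of_forall hF) hU) fun i => (hF i).deriv hU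

namespace ConvergentLaurent

/-! ### Rounding a real polynomial to an integral power series -/

section Product

/-- The partial products of `∏ (1 + c_k X ^ (k + 1))`. -/
noncomputable def partialProd (c : ℕ → ℝ) (m : ℕ) : Polynomial ℝ :=
  ∏ k ∈ Finset.range m, (1 + Polynomial.C (c k) * Polynomial.X ^ (k + 1))

theorem coeff_mul_partialProd_succ (Q : Polynomial ℝ) (c : ℕ → ℝ) {m n : ℕ} (h : n ≤ m) :
    (Q * partialProd c (m + 1)).coeff n = (Q * partialProd c m).coeff n := by
  rw [partialProd, Finset.prod_range_succ, ← partialProd, ← mul_assoc, mul_add, mul_one,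
    Polynomial.coeff_add, add_eq_left, mul_left_comm, Polynomial.coeff_C_mul,
    Polynomial.coeff_mul_X_pow', if_neg (by omega), mul_zero]

/-- Because the constant coefficient is `1`, the new factor shifts the coefficient of degree `m + 1`
by exactly `c m`, while lower degrees are already settled. So each `c m` can be chosen to round one
coefficient. -/
theorem coeff_mul_partialProd_succ_self (Q : Polynomial ℝ) (hQ : Q.coeff 0 = 1) (c : ℕ → ℝ) (m : ℕ) :
    (Q * partialProd c (m + 1)).coeff (m + 1) = (Q * partialProd c m).coeff (m + 1) + c m := by
  have h0 : (Q * partialProd c m).coeff 0 = 1 := by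
    rw [Polynomial.mul_coeff_zero, hQ, one_mul, partialProd, Polynomial.coeff_zero_eq_eval_zero,
      Polynomial.eval_prod]
    simp
  rw [partialProd, Finset.prod_range_succ, ← partialProd, ← mul_assoc, mul_add, mul_one,
    Polynomial.coeff_add, mul_left_comm, Polynomial.coeff_C_mul, Polynomial.coeff_mul_X_pow',
    if_pos le_rfl, Nat.sub_self, h0, mul_one]

theorem coeff_mul_partialProd_of_le (Q : Polynomial ℝ) (c : ℕ → ℝ) {m n : ℕ} (h : n ≤ m) :
    (Q * partialProd c m).coeff n = (Q * partialProd c n).coeff n := by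
  induction m, h using Nat.le_induction with
  | base => rfl
  | succ m hm ih => rw [coeff_mul_partialProd_succ Q c hm, ih]

/-- The exponents `c_k ∈ [0, 1)` for which `Q * ∏ (1 + c_k X ^ (k + 1))` has integral coefficients,
together with the partial products. -/
noncomputable def integralizingPair (Q : Polynomial ℝ) : ℕ → Polynomial ℝ × ℝ
  | 0 => (Q, ⌈Q.coeff 1⌉ - Q.coeff 1)
  | m + 1 =>
    let P := (integralizingPair Q m).1 *
      (1 + Polynomial.C (integralizingPair Q m).2 * Polynomial.X ^ (m + 1))
    (P, ⌈P.coeff (m + 2)⌉ - P.coeff (m + 2))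

theorem exists_integralizing (Q : Polynomial ℝ) (hQ : Q.coeff 0 = 1) :
    ∃ c : ℕ → ℝ, (∀ k, 0 ≤ c k ∧ c k < 1) ∧
      ∃ g : ℕ → ℤ, g 0 = 1 ∧ ∀ m, (Q * partialProd c m).coeff m = g m := by
  let c : ℕ → ℝ := fun k => (integralizingPair Q k).2
  have h1 (m : ℕ) : (integralizingPair Q m).1 = Q * partialProd c m := by
    induction m with
    | zero => simp [integralizingPair, partialProd]
    | succ m ih =>
      rw [partialProd, Finset.prod_range_succ, ← partialProd, ← mul_assoc, ← ih]
      rfl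
  have h2 (m : ℕ) : c m = ⌈(Q * partialProd c m).coeff (m + 1)⌉ -
      (Q * partialProd c m).coeff (m + 1) := by
    rw [← h1]
    cases m <;> rfl
  refine ⟨c, fun k => ?_, fun m => if m = 0 then 1 else ⌈(Q * partialProd c (m - 1)).coeff m⌉,
    by simp, fun m => ?_⟩
  · rw [h2]
    have := Int.ceil_lt_add_one ((Q * partialProd c k).coeff (k + 1))
    have := Int.le_ceil ((Q * partialProd c k).coeff (k + 1))
    constructor <;> linarith
  · cases m with
    | zero => simp [partialProd, hQ]
    | succ m =>
      rw [coeff_mul_partialProd_succ_self Q hQ, h2]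
      simp

/-- Multiplying a real polynomial by a nowhere vanishing function on the unit disc makes its
expansion integral. -/
theorem exists_integral_mul (Q : Polynomial ℝ) (hQ : Q.coeff 0 = 1) :
    ∃ (u : ℂ → ℂ) (G : PowerSeries ℤ), PowerSeries.coeff 0 G = 1 ∧
      DifferentiableOn ℂ u (Metric.ball 0 1) ∧ (∀ z, ‖z‖ < 1 → u z ≠ 0) ∧
      HasExpansion (fun z => (Q.map Complex.ofRealHom).eval z * u z) (toComplex G) 1 := by
  obtain ⟨c, hc, g, hg0, hg⟩ := exists_integralizing Q hQ
  have hc' (k : ℕ) (z : ℂ) : ‖(c k : ℂ) * z ^ (k + 1)‖ ≤ ‖z‖ ^ (k + 1) := by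
    rw [norm_mul, norm_pow, Complex.norm_real, Real.norm_eq_abs, abs_of_nonneg (hc k).1]
    exact mul_le_of_le_one_left (by positivity) (hc k).2.le
  have hgeom {s : ℝ} (hs0 : 0 ≤ s) (hs : s < 1) : Summable fun k : ℕ => s ^ (k + 1) :=
    (summable_geometric_of_lt_one hs0 hs).comp_injective (add_left_injective 1)
  let u : ℂ → ℂ := fun z => ∏' k : ℕ, (1 + (c k : ℂ) * z ^ (k + 1))
  have hprod (m : ℕ) (z : ℂ) : ((partialProd c m).map Complex.ofRealHom).eval z =
      ∏ k ∈ Finset.range m, (1 + (c k : ℂ) * z ^ (k + 1)) := by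
    rw [partialProd, Polynomial.map_prod, Polynomial.eval_prod]
    simp
  have hlim {s : ℝ} (hs : s < 1) : TendstoLocallyUniformlyOn
      (fun m z => ((partialProd c m).map Complex.ofRealHom).eval z) u atTop (Metric.ball 0 s) := by
    rcases lt_or_ge s 0 with hs0 | hs0
    · rw [Metric.ball_eq_empty.2 hs0.le]
      exact fun _ _ x hx => hx.elim
    have h := Summable.hasProdLocallyUniformlyOn_nat_one_add (f := fun k (z : ℂ) => (c k : ℂ) * z ^ (k + 1))
      (Metric.isOpen_ball (x := (0 : ℂ)) (ε := s)) (hgeom hs0 hs)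
      (.of_forall fun k z hz => (hc' k z).trans
        (pow_le_pow_left₀ (norm_nonneg _) (by simpa using (Metric.mem_ball.1 hz).le) _))
      (fun k => by fun_prop)
    intro V hV z hz
    obtain ⟨t, ht, h'⟩ := h V hV z hz
    refine ⟨t, ht, (tendsto_finset_range.eventually h').mono fun m hm y hy => ?_⟩
    simpa only [hprod] using hm y hy
  have hdiff : DifferentiableOn ℂ u (Metric.ball 0 1) := by
    intro z hz
    obtain ⟨s, hs, hs'⟩ := exists_between (Metric.mem_ball.1 hz)
    have h := (hlim hs').differentiableOn (.of_forall fun m => by fun_prop) Metric.isOpen_ball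
    exact (h.differentiableAt (Metric.isOpen_ball.mem_nhds hs)).differentiableWithinAt
  -- Each factor is nonzero since `‖c_k z^(k+1)‖ < 1`, and an absolutely convergent product of
  -- nonzero factors is nonzero.
  have hne (z : ℂ) (hz : ‖z‖ < 1) : u z ≠ 0 := by
    refine tprod_one_add_ne_zero_of_summable (fun k h => ?_)
      (Summable.of_nonneg_of_le (fun k => norm_nonneg _) (fun k => hc' k z)
        (hgeom (norm_nonneg z) hz))
    have h1 : ‖(c k : ℂ) * z ^ (k + 1)‖ = 1 := by
      rw [eq_neg_of_add_eq_zero_right h, norm_neg, norm_one]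
    have h2 := hc' k z
    rw [h1] at h2
    exact h2.not_gt (pow_lt_one₀ (norm_nonneg z) hz (by omega))
  have hexp := HasExpansion.taylor hdiff
  set U : PowerSeries ℂ := PowerSeries.mk fun n => (n.factorial : ℂ)⁻¹ * iteratedDeriv n u 0 with hU
  -- Locally uniform convergence passes to derivatives at `0`, and the `n`-th coefficients of the
  -- partial products are constant from index `n` on.
  have hcoeff (n : ℕ) : PowerSeries.coeff n U = (partialProd c n).coeff n := by
    have h1 := ((hlim (s := 1 / 2) (by norm_num)).iteratedDeriv_complex Metric.isOpen_ball n
      (fun m => by fun_prop)).tendsto_at (a := 0) (by simp)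
    have h2 := h1.const_mul (n.factorial : ℂ)⁻¹
    have h3 (m : ℕ) (hm : n ≤ m) : (n.factorial : ℂ)⁻¹ *
        iteratedDeriv n (fun z => ((partialProd c m).map Complex.ofRealHom).eval z) 0 =
          (partialProd c n).coeff n := by
      have h4 := (HasExpansion.taylor (φ := fun z => ((partialProd c m).map Complex.ofRealHom).eval z)
        (ρ := 1) (by fun_prop)).unique (HasExpansion.coe_polynomial _ 1) one_pos
      have h5 := congrArg (PowerSeries.coeff n) h4
      rw [PowerSeries.coeff_mk, Polynomial.coeff_coe, Polynomial.coeff_map] at h5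
      have h6 := coeff_mul_partialProd_of_le 1 c hm
      rw [one_mul, one_mul] at h6
      rw [h5, h6]
      rfl
    rw [hU, PowerSeries.coeff_mk]
    refine tendsto_nhds_unique h2 (tendsto_const_nhds.congr' ?_)
    filter_upwards [eventually_ge_atTop n] with m hm using (h3 m hm).symm
  refine ⟨u, PowerSeries.mk g, by simp [hg0], hdiff, hne, ?_⟩
  have h := (HasExpansion.coe_polynomial (Q.map Complex.ofRealHom) 1).mul hexp
  suffices h0 : toComplex (PowerSeries.mk g) =
      (Q.map Complex.ofRealHom : PowerSeries ℂ) * U by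
    rw [h0]
    exact h
  ext n
  have h7 : ((Q * partialProd c n).coeff n : ℂ) = (g n : ℂ) := by
    rw [hg]
    simp
  rw [coeff_toComplex, PowerSeries.coeff_mk, ← h7, Polynomial.coeff_mul, PowerSeries.coeff_mul]
  push_cast
  refine Finset.sum_congr rfl fun q hq => ?_
  have hq' := Finset.HasAntidiagonal.mem_antidiagonal.1 hq
  have h8 := coeff_mul_partialProd_of_le 1 c (show q.2 ≤ n by omega)
  rw [one_mul, one_mul] at h8
  rw [Polynomial.coeff_map, hcoeff, h8]
  rfl

end Product

/-! ### Real polynomials with zeros at a point and its conjugate -/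

section Quadratic

/-- The divided slope at `x` is holomorphic. The factor is normalized to `1 - x⁻¹ z` so that its
constant coefficient is `1`. -/
theorem exists_mul_of_apply_eq_zero {φ : ℂ → ℂ} {ρ : ℝ}
    (hφ : DifferentiableOn ℂ φ (Metric.ball 0 ρ)) {x : ℂ} (hx : x ≠ 0) (hxρ : ‖x‖ < ρ)
    (h : φ x = 0) : ∃ η : ℂ → ℂ, DifferentiableOn ℂ η (Metric.ball 0 ρ) ∧
      ∀ z, φ z = (1 - x⁻¹ * z) * η z := by
  refine ⟨fun z => -x * dslope φ x z, ?_, fun z => ?_⟩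
  · exact ((Complex.differentiableOn_dslope
      (Metric.isOpen_ball.mem_nhds (by simpa using hxρ))).2 hφ).const_mul _
  · have h1 := sub_smul_dslope φ x z
    rw [h, sub_zero, smul_eq_mul] at h1
    rw [← h1]
    field_simp
    ring

/-- A real polynomial with simple zeros at `x` and its conjugate. -/
theorem exists_real_polynomial {x : ℂ} (hx : x ≠ 0) : ∃ Q : Polynomial ℝ, Q.coeff 0 = 1 ∧
    (∀ z, (Q.map Complex.ofRealHom).eval z = 0 ↔ z = x ∨ z = starRingEnd ℂ x) ∧
    ∀ (φ : ℂ → ℂ) (ρ : ℝ), DifferentiableOn ℂ φ (Metric.ball 0 ρ) → ‖x‖ < ρ → φ x = 0 →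
      φ (starRingEnd ℂ x) = 0 → ∃ η : ℂ → ℂ, DifferentiableOn ℂ η (Metric.ball 0 ρ) ∧
        ∀ z, φ z = (Q.map Complex.ofRealHom).eval z * η z := by
  have hx' : starRingEnd ℂ x ≠ 0 := by simpa using hx
  by_cases hc : starRingEnd ℂ x = x
  · obtain ⟨a, rfl⟩ := Complex.conj_eq_iff_real.1 hc
    have ha : (a : ℂ) ≠ 0 := hx
    have he (z : ℂ) : ((1 - Polynomial.C a⁻¹ * Polynomial.X : Polynomial ℝ).map
        Complex.ofRealHom).eval z = 1 - (a : ℂ)⁻¹ * z := by simp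
    refine ⟨1 - Polynomial.C a⁻¹ * Polynomial.X, by simp, fun z => ?_, fun φ ρ h1 h2 h3 _ => ?_⟩
    · rw [he, hc, or_self, sub_eq_zero, eq_comm, inv_mul_eq_one₀ ha, eq_comm]
    · simp only [he]
      exact exists_mul_of_apply_eq_zero h1 hx h2 h3
  · have hn : (Complex.normSq x : ℂ) = x * starRingEnd ℂ x := (Complex.mul_conj x).symm
    have ht : ((2 * x.re : ℝ) : ℂ) = x + starRingEnd ℂ x := by rw [Complex.add_conj]
    let Q : Polynomial ℝ := 1 - Polynomial.C (2 * x.re / Complex.normSq x) * Polynomial.X +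
      Polynomial.C (Complex.normSq x)⁻¹ * Polynomial.X ^ 2
    have he (z : ℂ) : (Q.map Complex.ofRealHom).eval z =
        (1 - x⁻¹ * z) * (1 - (starRingEnd ℂ x)⁻¹ * z) := by
      have : (Q.map Complex.ofRealHom).eval z = 1 - ((2 * x.re : ℝ) : ℂ) / (Complex.normSq x : ℂ) * z
          + (Complex.normSq x : ℂ)⁻¹ * z ^ 2 := by simp [Q]
      rw [this, hn, ht]
      field_simp
      ring
    refine ⟨Q, by simp [Q], fun z => ?_, fun φ ρ h1 h2 h3 h4 => ?_⟩
    · rw [he, mul_eq_zero]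
      refine or_congr ?_ ?_
      · rw [sub_eq_zero, eq_comm, inv_mul_eq_one₀ hx, eq_comm]
      · rw [sub_eq_zero, eq_comm, inv_mul_eq_one₀ hx', eq_comm]
    · obtain ⟨η, h5, h6⟩ := exists_mul_of_apply_eq_zero h1 hx h2 h3
      -- For non-real `x` the first linear factor does not vanish at the conjugate, so the zero
      -- there passes to `η`.
      have h7 : η (starRingEnd ℂ x) = 0 := by
        have h8 := h6 (starRingEnd ℂ x)
        rw [h4, eq_comm, mul_eq_zero, sub_eq_zero, eq_comm, inv_mul_eq_one₀ hx] at h8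
        exact h8.resolve_left fun h => hc h.symm
      obtain ⟨θ, h9, h10⟩ := exists_mul_of_apply_eq_zero h5 hx' (by simpa using h2) h7
      exact ⟨θ, h9, fun z => by rw [he, h6, h10, mul_assoc]⟩

end Quadratic

/-! ### Correcting coefficients modulo a power series -/

section Recursion

variable {R : Type*} [CommRing R] (F Q : PowerSeries R) (ψ : ℕ → R → R)

/-- The coefficients of the power series `v` of `exists_coeff_recursion`. -/
noncomputable def recursionCoeff (n : ℕ) : R :=
  ψ n (PowerSeries.coeff n F + ∑ i : Fin n, recursionCoeff i * PowerSeries.coeff (n - i) Q)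
termination_by n
decreasing_by exact i.2

/-- In degree `n`, the product `v * Q` is `v_n * Q_0` plus terms in earlier coefficients of `v`.
With `a` collecting everything already known, `ψ n a` is a free choice of `v_n`. It serves for
rounding over `ℝ` and for reduction to bounded integers over `ℤ_p`. -/
theorem exists_coeff_recursion : ∃ v : PowerSeries R, ∀ n, ∃ a,
    PowerSeries.coeff n v = ψ n a ∧
      PowerSeries.coeff n (F + v * Q) = a + ψ n a * PowerSeries.coeff 0 Q := by
  have h (n : ℕ) : recursionCoeff F Q ψ n = ψ n (PowerSeries.coeff n F +
      ∑ i : Fin n, recursionCoeff F Q ψ i * PowerSeries.coeff (n - i) Q) := by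
    rw [recursionCoeff]
  refine ⟨PowerSeries.mk (recursionCoeff F Q ψ), fun n => ⟨PowerSeries.coeff n F +
    ∑ i : Fin n, recursionCoeff F Q ψ i * PowerSeries.coeff (n - i) Q, ?_, ?_⟩⟩
  · exact (PowerSeries.coeff_mk n _).trans (h n)
  · rw [← h, map_add, PowerSeries.coeff_mul,
      Finset.Nat.sum_antidiagonal_eq_sum_range_succ_mk, Finset.sum_range_succ, Nat.sub_self,
      ← Fin.sum_univ_eq_sum_range (fun i => PowerSeries.coeff i (PowerSeries.mk
        (recursionCoeff F Q ψ)) * PowerSeries.coeff (n - i) Q)]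
    simp only [PowerSeries.coeff_mk, add_assoc]

end Recursion

end ConvergentLaurent

namespace ConvergentLaurent

/-! ### Division in the ring and kernels at complex points -/

theorem HasExpansion.add {φ ψ : ℂ → ℂ} {F G : PowerSeries ℂ} {ρ : ℝ} (hF : HasExpansion φ F ρ)
    (hG : HasExpansion ψ G ρ) : HasExpansion (φ + ψ) (F + G) ρ := by
  intro z hz
  refine ((hF z hz).add (hG z hz)).congr_fun fun n => ?_
  rw [map_add, add_mul]

theorem HasExpansion.sumAt_eq {r ρ : ℝ} {φ : ℂ → ℂ} {F : convPS r}
    (h : HasExpansion φ (toComplex F) ρ) {z : ℂ} (hz : ‖z‖ < ρ) : sumAt F z = φ z :=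
  h.tsum_eq hz

theorem exists_hasExpansion₂ {r : ℝ} (hr : 0 ≤ r) (F G : convPS r) :
    ∃ ρ, r < ρ ∧ HasExpansion (sumAt F) (toComplex F) ρ ∧ HasExpansion (sumAt G) (toComplex G) ρ := by
  obtain ⟨ρ, hρ, h⟩ := exists_hasExpansion hr F
  obtain ⟨σ, hσ, h'⟩ := exists_hasExpansion hr G
  exact ⟨min ρ σ, lt_min hρ hσ, h.mono (min_le_left _ _), h'.mono (min_le_right _ _)⟩

theorem sumAt_mul {r : ℝ} (hr : 0 ≤ r) (F G : convPS r) {z : ℂ} (hz : ‖z‖ ≤ r) :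
    sumAt (F * G) z = sumAt F z * sumAt G z := by
  obtain ⟨ρ, hρ, h, h'⟩ := exists_hasExpansion₂ hr F G
  have := h.mul h'
  rw [← map_mul] at this
  exact HasExpansion.sumAt_eq (F := F * G) this (hz.trans_lt hρ)

theorem sumAt_conj {r : ℝ} (F : convPS r) (z : ℂ) :
    sumAt F (starRingEnd ℂ z) = starRingEnd ℂ (sumAt F z) := by
  rw [sumAt, sumAt, Complex.conj_tsum]
  simp

theorem sumAt_zero {r : ℝ} (F : convPS r) :
    sumAt F 0 = (PowerSeries.coeff 0 (F : PowerSeries ℤ) : ℤ) := by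
  rw [sumAt, tsum_eq_single 0]
  · simp
  · intro n hn
    simp [hn]

/-- A quotient of convergent power series with holomorphic quotient is convergent. -/
theorem mem_convPS_of_mul_eq {r : ℝ} (hr : 0 ≤ r) {F G : convPS r} (hG : G ≠ 0) {ρ : ℝ}
    (hρ : r < ρ) {η : ℂ → ℂ} (hη : DifferentiableOn ℂ η (Metric.ball 0 ρ))
    (h : ∀ z, ‖z‖ < ρ → sumAt F z = sumAt G z * η z) {H : PowerSeries ℤ}
    (hH : (F : PowerSeries ℤ) = G * H) : H ∈ convPS r := by
  obtain ⟨σ, hσ, h1, h2⟩ := exists_hasExpansion₂ hr F G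
  refine (mem_convPS_iff hr).2 ⟨η, min ρ σ, lt_min hρ hσ, ?_⟩
  refine (h1.mono (min_le_right _ _)).of_mul_eq (h2.mono (min_le_right _ _))
    (hr.trans_lt (lt_min hρ hσ)) ?_ (hη.mono (Metric.ball_subset_ball (min_le_left _ _)))
    (fun z hz => h z (hz.trans_le (min_le_left _ _))) (by rw [hH, map_mul])
  intro h0
  exact hG (Subtype.ext (toComplex_injective (by simpa using h0)))

/-- `F` has no zeros on the closed disc of radius `r`. -/
def ZeroFree {r : ℝ} (F : convPS r) : Prop := ∀ z, ‖z‖ ≤ r → sumAt F z ≠ 0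

/-- By compactness `G` has no zeros on a slightly larger disc either, so `F / G` is holomorphic
there and only the formal divisibility matters. -/
theorem ZeroFree.mem_of_mul_eq {r : ℝ} (hr : 0 ≤ r) {F G : convPS r} (hG : ZeroFree G)
    {H : PowerSeries ℤ} (hH : (F : PowerSeries ℤ) = G * H) : H ∈ convPS r := by
  obtain ⟨ρ, hρ, hF', hG'⟩ := exists_hasExpansion₂ hr F G
  have hρ0 := hr.trans_lt hρ
  have hd := hG'.differentiableOn hρ0
  have ho : IsOpen (Metric.ball (0 : ℂ) ρ ∩ sumAt G ⁻¹' {0}ᶜ) :=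
    hd.continuousOn.isOpen_inter_preimage Metric.isOpen_ball isOpen_compl_singleton
  have hsub : Metric.closedBall (0 : ℂ) r ⊆ Metric.ball (0 : ℂ) ρ ∩ sumAt G ⁻¹' {0}ᶜ :=
    fun z hz => ⟨Metric.closedBall_subset_ball hρ hz, hG z (by simpa using hz)⟩
  obtain ⟨δ, hδ, hδ'⟩ := (isCompact_closedBall (0 : ℂ) r).exists_thickening_subset_open ho hsub
  rw [thickening_closedBall hδ hr, add_comm] at hδ'
  have hne : G ≠ 0 := by
    rintro rfl
    exact hG 0 (by simpa using hr) (by simp [sumAt])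
  refine mem_convPS_of_mul_eq hr (F := F) hne (show r < r + δ by linarith)
    (η := fun z => sumAt F z / sumAt G z) ?_ (fun z hz => ?_) hH
  · have hs := hδ'.trans Set.inter_subset_left
    exact ((hF'.differentiableOn hρ0).mono hs).div (hd.mono hs) fun z hz => (hδ' hz).2
  · rw [mul_div_cancel₀]
    exact (hδ' (by simpa using hz)).2

/-- A power series with constant coefficient `1` generating the kernel of the evaluation at `x`. -/
theorem exists_generator_complex {r : ℝ} (hr1 : r < 1) {x : ℂ} (hx : x ≠ 0) (hxr : ‖x‖ ≤ r) :
    ∃ G : convPS r, PowerSeries.coeff 0 (G : PowerSeries ℤ) = 1 ∧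
      (∀ z, ‖z‖ ≤ r → (sumAt G z = 0 ↔ z = x ∨ z = starRingEnd ℂ x)) ∧
      ∀ F : convPS r, sumAt F x = 0 → G ∣ F := by
  have hr0 : 0 ≤ r := (norm_nonneg x).trans hxr
  obtain ⟨Q, hQ0, hQ, hdiv⟩ := exists_real_polynomial hx
  obtain ⟨u, G, hG0, hu, hu0, hG⟩ := exists_integral_mul Q hQ0
  let G' : convPS r := ⟨G, (mem_convPS_iff hr0).2 ⟨_, 1, hr1, hG⟩⟩
  have hGz {z : ℂ} (hz : ‖z‖ < 1) : sumAt G' z = (Q.map Complex.ofRealHom).eval z * u z :=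
    HasExpansion.sumAt_eq (F := G') hG hz
  refine ⟨G', hG0, fun z hz => ?_, fun F hF => ?_⟩
  · have hz1 := hz.trans_lt hr1
    rw [hGz hz1, mul_eq_zero, or_iff_left (hu0 z hz1), hQ]
  · obtain ⟨ρ, hρ, h⟩ := exists_hasExpansion hr0 F
    have hρ0 := hr0.trans_lt hρ
    obtain ⟨η, h1, h2⟩ := hdiv (sumAt F) ρ (h.differentiableOn hρ0) (hxr.trans_lt hρ) hF
      (by rw [sumAt_conj, hF, map_zero])
    -- Constant coefficient `1` makes the quotient exist over `ℤ`; only its convergence remains.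
    have hunit : IsUnit G := PowerSeries.isUnit_iff_constantCoeff.2 (by
      rw [← PowerSeries.coeff_zero_eq_constantCoeff_apply, hG0]
      exact isUnit_one)
    obtain ⟨H, hH⟩ := hunit.dvd (a := (F : PowerSeries ℤ))
    have hne : G' ≠ 0 := fun h0 => by
      have := congrArg (fun F : convPS r => PowerSeries.coeff 0 (F : PowerSeries ℤ)) h0
      simp [G', hG0] at this
    have hsub : Metric.ball (0 : ℂ) (min ρ 1) ⊆ Metric.ball 0 1 :=
      Metric.ball_subset_ball (min_le_right _ _)
    -- As `G = Q * u` and `F = Q * η`, the quotient is `η / u`, with `u` nowhere zero on the unit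
    -- disc.
    refine ⟨⟨H, mem_convPS_of_mul_eq hr0 (F := F) (G := G') hne (lt_min hρ hr1)
      (η := fun z => η z / u z) ?_ (fun z hz => ?_) hH⟩, Subtype.ext hH⟩
    · exact (h1.mono (Metric.ball_subset_ball (min_le_left _ _))).div (hu.mono hsub)
        fun z hz => hu0 z (by simpa using hsub hz)
    · have hz1 := hz.trans_le (min_le_right _ _)
      rw [hGz hz1, h2, mul_assoc, mul_div_cancel₀ _ (hu0 z hz1)]

/-- Adding a multiple `v * Q` of a polynomial vanishing at `x` keeps the value `c`, while `v` is
chosen to make all coefficients integers. -/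
theorem exists_sumAt_eq_real {r : ℝ} (hr1 : r < 1) {x : ℂ} (hx : x ≠ 0) (hxr : ‖x‖ ≤ r) (c : ℝ) :
    ∃ F : convPS r, sumAt F x = c := by
  have hr0 : 0 ≤ r := (norm_nonneg x).trans hxr
  obtain ⟨Q, hQ0, hQ, -⟩ := exists_real_polynomial hx
  obtain ⟨v, hv⟩ := exists_coeff_recursion (PowerSeries.C c) (Q : PowerSeries ℝ)
    -- Since `Q_0 = 1`, this correction turns `a` into `⌈a⌉`; its values in `[0, 1)` make `v`
    -- converge on the unit disc.
    fun _ a => ⌈a⌉ - a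
  choose a hva hFa using hv
  let V : PowerSeries ℂ := PowerSeries.map Complex.ofRealHom v
  have hV : HasExpansion _ V 1 := hasExpansion_one_of_bounded (C := 1) fun n => by
    have h1 := Int.ceil_lt_add_one (a n)
    have h2 := Int.le_ceil (a n)
    rw [PowerSeries.coeff_map, hva, Complex.ofRealHom_eq_coe, Complex.norm_real, Real.norm_eq_abs,
      abs_le]
    constructor <;> linarith
  have h1 := (HasExpansion.coe_polynomial (Polynomial.C (c : ℂ)) 1).add
    (hV.mul (HasExpansion.coe_polynomial (Q.map Complex.ofRealHom) 1))
  have h2 : toComplex (PowerSeries.mk fun n => ⌈a n⌉) =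
      (Polynomial.C (c : ℂ) : PowerSeries ℂ) + V * (Q.map Complex.ofRealHom : PowerSeries ℂ) := by
    have h3 : (Polynomial.C (c : ℂ) : PowerSeries ℂ) + V * (Q.map Complex.ofRealHom : PowerSeries ℂ)
        = PowerSeries.map Complex.ofRealHom (PowerSeries.C c + v * (Q : PowerSeries ℝ)) := by
      rw [map_add, map_mul, PowerSeries.map_C, Polynomial.polynomial_map_coe, Polynomial.coe_C]
      rfl
    rw [h3]
    ext n
    rw [PowerSeries.coeff_map, hFa, coeff_toComplex, PowerSeries.coeff_mk, Polynomial.coeff_coe, hQ0]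
    simp
  rw [← h2] at h1
  let F : convPS r := ⟨PowerSeries.mk fun n => ⌈a n⌉, (mem_convPS_iff hr0).2 ⟨_, 1, hr1, h1⟩⟩
  refine ⟨F, (HasExpansion.sumAt_eq (F := F) h1 (hxr.trans_lt hr1)).trans ?_⟩
  rw [Pi.add_apply, Pi.mul_apply, (hQ x).2 (Or.inl rfl), mul_zero, add_zero, Polynomial.eval_C]

/-- The image is a `K`-subalgebra of an algebraic extension, hence a field. -/
theorem ker_isMaximal_of_le_range {K L R : Type*} [Field K] [Field L] [Algebra K L]
    [Algebra.IsAlgebraic K L] [CommRing R] (f : R →+* L)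
    (h : ∀ c : K, ∃ a, f a = algebraMap K L c) : (RingHom.ker f).IsMaximal := by
  let S : Subalgebra K L := { f.range with algebraMap_mem' := h }
  have hS : IsField S := S.isField_of_algebraic
  have hS' : IsField f.range := hS
  let := hS'.toField
  have := RingHom.ker_isMaximal_of_surjective f.rangeRestrict f.rangeRestrict_surjective
  rwa [RingHom.ker_rangeRestrict] at this

theorem ker_evalComplex_isMaximal {r : ℝ} (hr1 : r < 1) {x : ℂ} (hx : x ≠ 0) (hxr : ‖x‖ ≤ r) :
    (RingHom.ker (evalComplex x hx hxr)).IsMaximal := by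
  refine ker_isMaximal_of_le_range (K := ℝ) _ fun c => ?_
  obtain ⟨F, hF⟩ := exists_sumAt_eq_real hr1 hx hxr c
  exact ⟨ofPS r F, by rw [evalComplex_ofPS, hF]; rfl⟩

/-- The kernel of a homomorphism is generated by `G` if this holds on power series. -/
theorem ker_eq_span {r : ℝ} {K : Type*} [Field K] (e : convergentLaurent r →+* K) {G : convPS r}
    (hG : e (ofPS r G) = 0) (h : ∀ F, e (ofPS r F) = 0 → G ∣ F) :
    RingHom.ker e = Ideal.span {ofPS r G} := by
  refine le_antisymm (fun f hf => ?_) ?_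
  · rw [Ideal.mem_span_singleton]
    rcases eq_or_ne f 0 with rfl | hf0
    · exact dvd_zero _
    obtain ⟨m, F, -, rfl⟩ := exists_eq_unitT_mul hf0
    rw [RingHom.mem_ker, map_mul] at hf
    have hu := ((unitT r m).isUnit.map e).ne_zero
    exact ((map_dvd (ofPS r) (h F ((mul_eq_zero.1 hf).resolve_left hu)))).mul_left _
  · rw [Ideal.span_singleton_le_iff_mem]
    exact hG

end ConvergentLaurent

namespace ConvergentLaurent

/-! ### Splitting off the complex zeros -/

section Zeros

variable {r : ℝ}

theorem sumAt_analyticAt (hr : 0 ≤ r) (F : convPS r) {z : ℂ} (hz : ‖z‖ ≤ r) :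
    AnalyticAt ℂ (sumAt F) z := by
  obtain ⟨ρ, hρ, h⟩ := exists_hasExpansion hr F
  exact h.analyticAt (hz.trans_lt hρ)

theorem sumAt_zero_ne_zero {F : convPS r} (hF : PowerSeries.coeff 0 (F : PowerSeries ℤ) ≠ 0) :
    sumAt F 0 ≠ 0 := by
  rw [sumAt_zero]
  exact_mod_cast hF

theorem analyticOrderAt_sumAt_ne_top (hr : 0 ≤ r) {F : convPS r}
    (hF : PowerSeries.coeff 0 (F : PowerSeries ℤ) ≠ 0) {z : ℂ} (hz : ‖z‖ ≤ r) :
    analyticOrderAt (sumAt F) z ≠ ⊤ := by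
  have ha : AnalyticOnNhd ℂ (sumAt F) (Metric.closedBall 0 r) :=
    fun w hw => sumAt_analyticAt hr F (by simpa using hw)
  refine ha.analyticOrderAt_ne_top_of_isPreconnected (convex_closedBall 0 r).isPreconnected
    (x := 0) (by simpa using hr) (by simpa using hz) ?_
  rw [analyticOrderAt_eq_zero.2 (Or.inr (sumAt_zero_ne_zero hF))]
  exact ENat.zero_ne_top

theorem finite_zeros_sumAt (hr : 0 ≤ r) {F : convPS r}
    (hF : PowerSeries.coeff 0 (F : PowerSeries ℤ) ≠ 0) :
    {z : ℂ | ‖z‖ ≤ r ∧ sumAt F z = 0}.Finite := by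
  by_contra h
  have ha : AnalyticOnNhd ℂ (sumAt F) (Metric.closedBall 0 r) :=
    fun w hw => sumAt_analyticAt hr F (by simpa using hw)
  obtain ⟨z, hz, hz'⟩ := Set.Infinite.exists_accPt_of_subset_isCompact h
    (isCompact_closedBall (0 : ℂ) r) fun z hz => by simpa using hz.1
  have h0 := ha.eqOn_zero_of_preconnected_of_frequently_eq_zero
    (convex_closedBall 0 r).isPreconnected hz
    ((accPt_iff_frequently_nhdsNE.1 hz').mono fun w hw => hw.2)
  exact sumAt_zero_ne_zero hF (h0 (by simpa using hr))

/-- Generators of the kernels of evaluation at complex numbers. -/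
def IsComplexGenerator (G : convPS r) : Prop :=
  PowerSeries.coeff 0 (G : PowerSeries ℤ) = 1 ∧ ∃ (x : ℂ) (hx : x ≠ 0) (hxr : ‖x‖ ≤ r),
    RingHom.ker (evalComplex x hx hxr) = Ideal.span {ofPS r G}

theorem exists_prod_mul_zeroFree (hr : 0 ≤ r) (hr1 : r < 1) {F : convPS r}
    (hF : PowerSeries.coeff 0 (F : PowerSeries ℤ) ≠ 0) :
    ∃ s : Multiset (convPS r), (∀ G ∈ s, IsComplexGenerator G) ∧
      ∃ H, ZeroFree H ∧ F = s.prod * H := by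
  -- Induction on a bound for the total order of vanishing. The set `S` stays fixed, since the zeros
  -- of a quotient remain in it.
  suffices h : ∀ (n : ℕ) (S : Finset ℂ), (∀ z ∈ S, ‖z‖ ≤ r) → ∀ F : convPS r,
      PowerSeries.coeff 0 (F : PowerSeries ℤ) ≠ 0 → (∀ z, ‖z‖ ≤ r → sumAt F z = 0 → z ∈ S) →
      ∑ z ∈ S, analyticOrderNatAt (sumAt F) z ≤ n → ∃ s : Multiset (convPS r),
        (∀ G ∈ s, IsComplexGenerator G) ∧ ∃ H, ZeroFree H ∧ F = s.prod * H by
    have hfin := finite_zeros_sumAt hr hF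
    exact h _ hfin.toFinset (fun z hz => (hfin.mem_toFinset.1 hz).1) F hF
      (fun z h1 h2 => hfin.mem_toFinset.2 ⟨h1, h2⟩) le_rfl
  intro n S hS
  induction n with
  | zero =>
    intro F hF hFS hn
    refine ⟨0, by simp, F, fun z hz h0 => ?_, by simp⟩
    have h1 := (Finset.sum_eq_zero_iff.1 (Nat.le_zero.1 hn)) z (hFS z hz h0)
    have h2 := Nat.cast_analyticOrderNatAt (analyticOrderAt_sumAt_ne_top hr hF hz)
    rw [h1, Nat.cast_zero, eq_comm, (sumAt_analyticAt hr F hz).analyticOrderAt_eq_zero] at h2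
    exact h2 h0
  | succ n ih =>
    intro F hF hFS hn
    by_cases hzf : ZeroFree F
    · exact ⟨0, by simp, F, hzf, by simp⟩
    simp only [ZeroFree, not_forall, not_not] at hzf
    obtain ⟨x, hxr, hx0⟩ := hzf
    have hx : x ≠ 0 := by
      rintro rfl
      exact sumAt_zero_ne_zero hF hx0
    obtain ⟨G, hG0, hG, hdiv⟩ := exists_generator_complex hr1 hx hxr
    obtain ⟨H, rfl⟩ := hdiv F hx0
    have hH : PowerSeries.coeff 0 (H : PowerSeries ℤ) ≠ 0 := by
      intro h
      apply hF
      rw [PowerSeries.coeff_zero_eq_constantCoeff_apply] at h ⊢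
      rw [Subring.coe_mul, map_mul, h, mul_zero]
    have hord : ∀ z ∈ S, analyticOrderNatAt (sumAt (G * H)) z =
        analyticOrderNatAt (sumAt G) z + analyticOrderNatAt (sumAt H) z := by
      intro z hz
      obtain ⟨ρ, hρ, h1, h2⟩ := exists_hasExpansion₂ hr G H
      have h3 := h1.mul h2
      rw [← map_mul] at h3
      have h4 : sumAt (G * H) =ᶠ[𝓝 z] sumAt G * sumAt H := by
        filter_upwards [Metric.isOpen_ball.mem_nhds (show z ∈ Metric.ball (0 : ℂ) ρ by
          simpa using (hS z hz).trans_lt hρ)] with w hw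
        exact HasExpansion.sumAt_eq (F := G * H) h3 (by simpa using hw)
      rw [analyticOrderNatAt, analyticOrderAt_congr h4, ← analyticOrderNatAt]
      exact analyticOrderNatAt_mul (sumAt_analyticAt hr G (hS z hz))
        (sumAt_analyticAt hr H (hS z hz))
        (analyticOrderAt_sumAt_ne_top hr (by rw [hG0]; exact one_ne_zero) (hS z hz))
        (analyticOrderAt_sumAt_ne_top hr hH (hS z hz))
    have hpos : 1 ≤ analyticOrderNatAt (sumAt G) x := by
      rw [Nat.one_le_iff_ne_zero]
      intro h1
      have h2 := Nat.cast_analyticOrderNatAt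
        (analyticOrderAt_sumAt_ne_top hr (F := G) (by rw [hG0]; exact one_ne_zero) hxr)
      rw [h1, Nat.cast_zero, eq_comm, (sumAt_analyticAt hr G hxr).analyticOrderAt_eq_zero] at h2
      exact h2 ((hG x hxr).2 (Or.inl rfl))
    have hxS := hFS x hxr hx0
    rw [Finset.sum_congr rfl hord, Finset.sum_add_distrib] at hn
    have hle := Finset.single_le_sum (fun z _ => Nat.zero_le (analyticOrderNatAt (sumAt G) z)) hxS
    obtain ⟨s, hs, K, hK, rfl⟩ := ih H hH
      (fun z hz h => hFS z hz (by rw [sumAt_mul hr _ _ hz, h, mul_zero])) (by omega)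
    refine ⟨G ::ₘ s, ?_, K, hK, by rw [Multiset.prod_cons, mul_assoc]⟩
    simp only [Multiset.mem_cons, forall_eq_or_imp]
    refine ⟨⟨hG0, x, hx, hxr, ker_eq_span _ ?_ fun F hF => hdiv F ?_⟩, hs⟩
    · rw [evalComplex_ofPS, (hG x hxr).2 (Or.inl rfl)]
    · rwa [evalComplex_ofPS] at hF

end Zeros

/-! ### Reduction modulo a prime -/

section ModP

variable {r : ℝ}

theorem coeff_natCast_mul {R : Type*} [Semiring R] (m n : ℕ) (F : PowerSeries R) :
    PowerSeries.coeff n ((m : PowerSeries R) * F) = m * PowerSeries.coeff n F := by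
  rw [← map_natCast (PowerSeries.C (R := R)), PowerSeries.coeff_C_mul]

/-- A nonzero constant is zero-free, so divisibility of all coefficients suffices. -/
theorem natCast_dvd_convPS (hr : 0 ≤ r) {m : ℕ} (hm : m ≠ 0) {F : convPS r}
    (h : ∀ n, (m : ℤ) ∣ PowerSeries.coeff n (F : PowerSeries ℤ)) : (m : convPS r) ∣ F := by
  choose a ha using h
  have hG : ZeroFree (m : convPS r) := by
    intro z _
    have hc (n : ℕ) : PowerSeries.coeff n (toComplex ((m : convPS r) : PowerSeries ℤ)) =
        if n = 0 then (m : ℂ) else 0 := by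
      rw [Subring.coe_natCast, map_natCast, ← map_natCast (PowerSeries.C (R := ℂ)),
        PowerSeries.coeff_C]
    have h1 : sumAt (m : convPS r) z = m := by
      rw [sumAt, tsum_eq_single 0]
      · rw [hc, if_pos rfl, pow_zero, mul_one]
      · intro n hn
        rw [hc, if_neg hn, zero_mul]
    rw [h1]
    exact_mod_cast hm
  have hH : (F : PowerSeries ℤ) = (m : convPS r) * PowerSeries.mk a := by
    ext n
    rw [ha, Subring.coe_natCast, coeff_natCast_mul, PowerSeries.coeff_mk]
  exact ⟨⟨_, hG.mem_of_mul_eq hr hH⟩, Subtype.ext hH⟩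

theorem X_pow_mem_convPS (hr : 0 ≤ r) (hr1 : r < 1) (k : ℕ) :
    (PowerSeries.X ^ k : PowerSeries ℤ) ∈ convPS r :=
  mem_convPS_of_bounded hr hr1 (C := 1) fun n => by
    rw [PowerSeries.coeff_X_pow]
    split_ifs <;> simp

theorem ofPS_X_pow (k : ℕ) (h : (PowerSeries.X ^ k : PowerSeries ℤ) ∈ convPS r) :
    ofPS r ⟨PowerSeries.X ^ k, h⟩ = unitT r k :=
  Subtype.ext (HahnSeries.ofPowerSeries_X_pow k)

theorem span_prime_isMaximal (hr : 0 ≤ r) (hr1 : r < 1) {p : ℕ} (hp : p.Prime) :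
    (Ideal.span {(p : convergentLaurent r)}).IsMaximal := by
  have := Fact.mk hp
  rw [Ideal.isMaximal_iff]
  constructor
  · rw [Ideal.mem_span_singleton]
    rintro ⟨g, hg⟩
    have h1 : (1 : LaurentSeries ℤ) = p • (g : LaurentSeries ℤ) := by
      rw [nsmul_eq_mul]
      exact congrArg Subtype.val hg
    replace h1 := congrArg (fun f : LaurentSeries ℤ => f.coeff 0) h1
    simp only [HahnSeries.coeff_one, if_pos, HahnSeries.coeff_smul] at h1
    rw [nsmul_eq_mul] at h1
    have h2 : (p : ℤ) ∣ 1 := ⟨_, h1⟩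
    exact hp.one_lt.ne' (by exact_mod_cast Int.eq_one_of_dvd_one (by positivity) h2)
  · intro J f hJ hf hfJ
    have hf0 : f ≠ 0 := by
      rintro rfl
      exact hf (Ideal.zero_mem _)
    obtain ⟨m, F, -, rfl⟩ := exists_eq_unitT_mul hf0
    have hFJ : ofPS r F ∈ J := by
      have := J.mul_mem_left ((unitT r m)⁻¹ : (convergentLaurent r)ˣ) hfJ
      rwa [Units.inv_mul_cancel_left] at this
    let red : PowerSeries ℤ →+* PowerSeries (ZMod p) := PowerSeries.map (Int.castRingHom (ZMod p))
    have hred {E : convPS r} (hE : red E = 0) : (p : convPS r) ∣ E := by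
      refine natCast_dvd_convPS hr hp.ne_zero fun n => ?_
      rw [← ZMod.intCast_zmod_eq_zero_iff_dvd]
      simpa [red] using congrArg (PowerSeries.coeff n) hE
    have hpJ {E : convPS r} (hE : red E = 0) : ofPS r E ∈ Ideal.span {(p : convergentLaurent r)} := by
      rw [Ideal.mem_span_singleton]
      simpa using map_dvd (ofPS r) (hred hE)
    have hF0 : red F ≠ 0 := fun h => hf (Ideal.mul_mem_left _ _ (hpJ h))
    -- Over the field `ZMod p`, the reduction of `F` times a unit `w` is `X^k`. Lifting `w` with
    -- digits in `[0, p)` gives a convergent `G` with `F * G` congruent to `X^k`, a unit, modulo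
    -- `p`.
    obtain ⟨k, w, hw⟩ := IsDiscreteValuationRing.associated_pow_irreducible hF0
      (PowerSeries.X_prime (R := ZMod p)).irreducible
    let G : convPS r := ⟨PowerSeries.mk fun n =>
      ((PowerSeries.coeff n (w : PowerSeries (ZMod p)) : ZMod p).val : ℤ),
      mem_convPS_of_bounded hr hr1 (C := p) fun n => by
        rw [PowerSeries.coeff_mk, Int.cast_natCast, Nat.abs_cast]
        exact_mod_cast (ZMod.val_lt _).le⟩
    have hG : red G = w := by
      ext n
      simp [red, G]
    let Y : convPS r := ⟨PowerSeries.X ^ k, X_pow_mem_convPS hr hr1 k⟩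
    have h1 := hJ (hpJ (E := F * G - Y) (by
      rw [AddSubgroupClass.coe_sub, Subring.coe_mul, map_sub, map_mul, hG, hw]
      simp [red, Y]))
    rw [map_sub, map_mul] at h1
    have h2 := (Submodule.sub_mem_iff_right J (J.mul_mem_right _ hFJ)).1 h1
    rw [ofPS_X_pow] at h2
    rw [J.eq_top_of_isUnit_mem h2 (unitT r k).isUnit]
    trivial

end ModP

end ConvergentLaurent

namespace ConvergentLaurent

/-! ### Evaluation of power series at `p`-adic points -/

/-- Evaluation of power series with coefficients of norm at most `1` at an element of norm less
than `1` of a complete normed field. -/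
noncomputable def boundedEval {R K : Type*} [CommRing R] [NormedField K] [CompleteSpace K]
    (c : R →+* K) (hc : ∀ a, ‖c a‖ ≤ 1) (x : K) (hx : ‖x‖ < 1) : PowerSeries R →+* K :=
  have hs (F : PowerSeries R) : Summable fun n : ℕ => ‖c (PowerSeries.coeff n F) * x ^ n‖ := by
    refine Summable.of_nonneg_of_le (fun n => norm_nonneg _) (fun n => ?_)
      (summable_geometric_of_lt_one (norm_nonneg x) hx)
    rw [norm_mul, norm_pow]
    exact mul_le_of_le_one_left (by positivity) (hc _)
  { toFun := fun F => ∑' n : ℕ, c (PowerSeries.coeff n F) * x ^ n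
    map_zero' := by simp
    map_one' := by
      rw [tsum_eq_single 0]
      · simp
      · intro n hn
        simp [PowerSeries.coeff_one, hn]
    map_add' := fun F G => by
      rw [← (hs F).of_norm.tsum_add (hs G).of_norm]
      simp [add_mul]
    map_mul' := fun F G => by
      rw [tsum_mul_tsum_eq_tsum_sum_antidiagonal_of_summable_norm (hs F) (hs G)]
      refine tsum_congr fun n => ?_
      rw [PowerSeries.coeff_mul, map_sum, Finset.sum_mul]
      refine Finset.sum_congr rfl fun q hq => ?_
      rw [← Finset.HasAntidiagonal.mem_antidiagonal.1 hq, pow_add, map_mul]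
      ring }

theorem hasSum_boundedEval {R K : Type*} [CommRing R] [NormedField K] [CompleteSpace K]
    (c : R →+* K) (hc : ∀ a, ‖c a‖ ≤ 1) (x : K) (hx : ‖x‖ < 1) (F : PowerSeries R) :
    HasSum (fun n : ℕ => c (PowerSeries.coeff n F) * x ^ n) (boundedEval c hc x hx F) := by
  refine (Summable.of_norm (Summable.of_nonneg_of_le (fun n => norm_nonneg _) (fun n => ?_)
      (summable_geometric_of_lt_one (norm_nonneg x) hx))).hasSum
  rw [norm_mul, norm_pow]
  exact mul_le_of_le_one_left (by positivity) (hc _)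

section Padic

variable {p : ℕ} [Fact p.Prime]

/-- The inclusion of the `p`-adic integers in the algebraic closure. -/
noncomputable def padicCoe (p : ℕ) [Fact p.Prime] : ℤ_[p] →+* PadicAlgCl p :=
  (algebraMap ℚ_[p] (PadicAlgCl p)).comp (algebraMap ℤ_[p] ℚ_[p])

theorem padicCoe_apply (a : ℤ_[p]) :
    padicCoe p a = algebraMap ℚ_[p] (PadicAlgCl p) (algebraMap ℤ_[p] ℚ_[p] a) := rfl

theorem norm_padicCoe (a : ℤ_[p]) : ‖padicCoe p a‖ = ‖a‖ :=
  PadicAlgCl.norm_extends p _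

theorem padicCoe_injective : Function.Injective (padicCoe p) :=
  (algebraMap ℚ_[p] (PadicAlgCl p)).injective.comp (IsFractionRing.injective ℤ_[p] ℚ_[p])

theorem exists_padicEval (x : PadicAlgCl p) (hx : ‖x‖ < 1) :
    ∃ e : PowerSeries ℤ_[p] →+* PadicAlgCl p, ∀ F,
      HasSum (fun n : ℕ => padicCoe p (PowerSeries.coeff n F) * x ^ n) (e F) := by
  -- The algebraic closure is not complete, so the sum is formed in the finite extension `ℚ_p(x)`.
  have := completeSpace_adjoin x
  let K := IntermediateField.adjoin ℚ_[p] {x}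
  let c : ℤ_[p] →+* K := (algebraMap ℚ_[p] K).comp (algebraMap ℤ_[p] ℚ_[p])
  have hc (a : ℤ_[p]) : ‖c a‖ ≤ 1 := (norm_padicCoe a).trans_le a.norm_le_one
  let y : K := IntermediateField.AdjoinSimple.gen ℚ_[p] x
  refine ⟨(algebraMap K (PadicAlgCl p)).comp (boundedEval c hc y hx), fun F => ?_⟩
  exact ((hasSum_boundedEval c hc y hx F).map (algebraMap K (PadicAlgCl p))
    continuous_subtype_val).congr_fun fun n => rfl

/-- Evaluation of power series over the `p`-adic integers. -/
noncomputable def padicEval (x : PadicAlgCl p) (hx : ‖x‖ < 1) :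
    PowerSeries ℤ_[p] →+* PadicAlgCl p :=
  (exists_padicEval x hx).choose

theorem hasSum_padicEval (x : PadicAlgCl p) (hx : ‖x‖ < 1) (F : PowerSeries ℤ_[p]) :
    HasSum (fun n : ℕ => padicCoe p (PowerSeries.coeff n F) * x ^ n) (padicEval x hx F) :=
  (exists_padicEval x hx).choose_spec F

theorem padicEval_coe (x : PadicAlgCl p) (hx : ‖x‖ < 1) (P : Polynomial ℤ_[p]) :
    padicEval x hx P = P.eval₂ (padicCoe p) x := by
  refine (hasSum_padicEval x hx P).unique ?_
  rw [Polynomial.eval₂_eq_sum_range]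
  simp only [Polynomial.coeff_coe]
  refine hasSum_sum_of_ne_finset_zero fun n hn => ?_
  rw [Polynomial.coeff_eq_zero_of_natDegree_lt (by simpa using hn), map_zero, zero_mul]

theorem padicEval_C (x : PadicAlgCl p) (hx : ‖x‖ < 1) (a : ℤ_[p]) :
    padicEval x hx (PowerSeries.C a) = padicCoe p a := by
  rw [← Polynomial.coe_C, padicEval_coe, Polynomial.eval₂_C]

/-- Integral power series as power series over the `p`-adic integers. -/
noncomputable def toPadic (p : ℕ) [Fact p.Prime] : PowerSeries ℤ →+* PowerSeries ℤ_[p] :=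
  PowerSeries.map (Int.castRingHom ℤ_[p])

@[simp]
theorem coeff_toPadic (F : PowerSeries ℤ) (n : ℕ) :
    PowerSeries.coeff n (toPadic p F) = ((PowerSeries.coeff n F : ℤ) : ℤ_[p]) := by
  simp [toPadic]

theorem toPadic_injective : Function.Injective (toPadic p) := by
  intro F G h
  ext n
  have := congrArg (PowerSeries.coeff n) h
  simpa using this

theorem evalPadic_ofPS_eq {r : ℝ} {x : PadicAlgCl p} (hx : x ≠ 0) (hn : IsTopologicallyNilpotent x)
    (F : convPS r) : evalPadic x hx hn (ofPS r F) =
      padicEval x (norm_lt_one_of_isTopologicallyNilpotent hn) (toPadic p F) := by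
  refine (evalPadic_ofPS hx hn F).unique ?_
  refine (hasSum_padicEval x (norm_lt_one_of_isTopologicallyNilpotent hn) _).congr_fun fun n => ?_
  rw [coeff_toPadic, map_intCast]

/-! ### Distinguished polynomials and Weierstrass division -/

theorem norm_le_inv_of_mem_maximalIdeal {a : ℤ_[p]} (ha : a ∈ IsLocalRing.maximalIdeal ℤ_[p]) :
    ‖a‖ ≤ (p : ℝ)⁻¹ := by
  rw [PadicInt.maximalIdeal_eq_span_p, Ideal.mem_span_singleton] at ha
  obtain ⟨b, rfl⟩ := ha
  rw [norm_mul, PadicInt.norm_p]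
  exact mul_le_of_le_one_right (by positivity) b.norm_le_one

/-- The minimal polynomial of an element of norm less than `1` is distinguished. -/
theorem exists_distinguished {x : PadicAlgCl p} (hx : ‖x‖ < 1) :
    ∃ Q : Polynomial ℤ_[p], Q.map (algebraMap ℤ_[p] ℚ_[p]) = minpoly ℚ_[p] x ∧
      Q.IsDistinguishedAt (IsLocalRing.maximalIdeal ℤ_[p]) := by
  have hint : IsIntegral ℚ_[p] x := Algebra.IsIntegral.isIntegral x
  have hmon := minpoly.monic hint
  -- The norm of `x` is the supremum of `‖a_i‖^(1/(d-i))` over the lower coefficients of its minimal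
  -- polynomial of degree `d`, so `‖x‖ < 1` bounds each of them.
  have hlt {i : ℕ} (hi : i < (minpoly ℚ_[p] x).natDegree) : ‖(minpoly ℚ_[p] x).coeff i‖ < 1 := by
    have h1 : spectralValueTerms (minpoly ℚ_[p] x) i ≤ ‖x‖ :=
      le_ciSup (spectralValueTerms_bddAbove _) i
    rw [spectralValueTerms_of_lt_natDegree _ hi] at h1
    by_contra! h2
    have hi' : (i : ℝ) < (minpoly ℚ_[p] x).natDegree := by exact_mod_cast hi
    exact (h1.trans_lt hx).not_ge (Real.one_le_rpow h2 (one_div_nonneg.2 (by linarith)))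
  have hlift : minpoly ℚ_[p] x ∈ Polynomial.lifts (algebraMap ℤ_[p] ℚ_[p]) := by
    rw [Polynomial.lifts_iff_coeff_lifts]
    intro i
    rcases lt_trichotomy i (minpoly ℚ_[p] x).natDegree with hi | rfl | hi
    · exact ⟨⟨_, (hlt hi).le⟩, rfl⟩
    · rw [hmon.coeff_natDegree]
      exact ⟨1, map_one _⟩
    · rw [Polynomial.coeff_eq_zero_of_natDegree_lt hi]
      exact ⟨0, map_zero _⟩
  obtain ⟨Q, hQ, hdeg, hQmon⟩ := Polynomial.lifts_and_natDegree_eq_and_monic hlift hmon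
  refine ⟨Q, hQ, ⟨fun {n} hn => ?_⟩, hQmon⟩
  rw [IsLocalRing.mem_maximalIdeal, PadicInt.mem_nonunits, PadicInt.norm_def]
  have h3 := hlt (hdeg ▸ hn)
  rwa [← hQ, Polynomial.coeff_map] at h3

theorem eval₂_padicCoe (Q : Polynomial ℤ_[p]) (x : PadicAlgCl p) :
    Q.eval₂ (padicCoe p) x = Polynomial.aeval x (Q.map (algebraMap ℤ_[p] ℚ_[p])) := by
  rw [Polynomial.aeval_def, Polynomial.eval₂_map]
  rfl

/-- If `‖x‖ ≥ 1`, the lower terms have norm at most `p⁻¹ ‖x‖^d` and cannot cancel the leading term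
`x^d`. -/
theorem norm_lt_one_of_isRoot {D : Polynomial ℤ_[p]}
    (hD : D.IsDistinguishedAt (IsLocalRing.maximalIdeal ℤ_[p])) {x : PadicAlgCl p}
    (hx : D.eval₂ (padicCoe p) x = 0) : ‖x‖ < 1 := by
  by_contra! h
  rw [Polynomial.eval₂_eq_sum_range, Finset.sum_range_succ, hD.monic.coeff_natDegree, map_one,
    one_mul, add_comm] at hx
  have h1 := congrArg norm (eq_neg_of_add_eq_zero_left hx)
  rw [norm_neg, norm_pow] at h1
  have h2 : ‖∑ i ∈ Finset.range D.natDegree, padicCoe p (D.coeff i) * x ^ i‖ ≤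
      (p : ℝ)⁻¹ * ‖x‖ ^ D.natDegree := by
    refine IsUltrametricDist.norm_sum_le_of_forall_le_of_nonneg (by positivity) fun i hi => ?_
    have hi' := Finset.mem_range.1 hi
    rw [norm_mul, norm_padicCoe, norm_pow]
    exact mul_le_mul (norm_le_inv_of_mem_maximalIdeal (hD.mem hi'))
      (pow_le_pow_right₀ h hi'.le) (by positivity) (by positivity)
  rw [← h1] at h2
  have hp : (1 : ℝ) < p := by exact_mod_cast (Fact.out : p.Prime).one_lt
  have h3 : (p : ℝ)⁻¹ < 1 := inv_lt_one_of_one_lt₀ hp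
  have h4 : 0 < ‖x‖ ^ D.natDegree := by positivity
  nlinarith

/-- The Weierstrass remainder has degree below that of the minimal polynomial and vanishes at `x`,
so it is zero. -/
theorem dvd_of_padicEval_eq_zero {x : PadicAlgCl p} (hx : ‖x‖ < 1) {Q : Polynomial ℤ_[p]}
    (hQ : Q.map (algebraMap ℤ_[p] ℚ_[p]) = minpoly ℚ_[p] x)
    (hQd : Q.IsDistinguishedAt (IsLocalRing.maximalIdeal ℤ_[p])) {F : PowerSeries ℤ_[p]}
    (hF : padicEval x hx F = 0) : (Q : PowerSeries ℤ_[p]) ∣ F := by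
  have hne : IsLocalRing.maximalIdeal ℤ_[p] ≠ ⊤ := Ideal.IsPrime.ne_top'
  obtain ⟨h1, h2⟩ := (hQd.isWeierstrassDivisorAt hne).isWeierstrassDivisionAt_div_mod F
  set q := (hQd.isWeierstrassDivisorAt hne).div F
  set s := (hQd.isWeierstrassDivisorAt hne).mod F
  have hdeg : Q.natDegree = _ := congr(ENat.toNat $(hQd.coe_natDegree_eq_order_map
    (Q : PowerSeries ℤ_[p]) 1 (by rwa [PowerSeries.constantCoeff_one, ← Ideal.ne_top_iff_one])
    (by simp)))
  have hQx : padicEval x hx (Q : PowerSeries ℤ_[p]) = 0 := by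
    rw [padicEval_coe, eval₂_padicCoe, hQ, minpoly.aeval]
  rw [h2, map_add, map_mul, hQx, zero_mul, zero_add, padicEval_coe, eval₂_padicCoe] at hF
  have hs : s.map (algebraMap ℤ_[p] ℚ_[p]) = 0 := by
    by_contra hs
    have h3 := minpoly.degree_le_of_ne_zero ℚ_[p] x hs hF
    rw [← hQ, hQd.monic.degree_map, Polynomial.degree_eq_natDegree hQd.monic.ne_zero, hdeg] at h3
    exact (Polynomial.degree_map_le.trans_lt h1).not_ge h3
  rw [Polynomial.map_eq_zero_iff (IsFractionRing.injective ℤ_[p] ℚ_[p])] at hs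
  rw [h2, hs, Polynomial.coe_zero, add_zero]
  exact dvd_mul_right _ _

/-! ### Integral generators and roots at `p`-adic points -/

/-- Every power series over the `p`-adic integers is congruent to an integral one modulo `Q`. -/
theorem exists_integral_congruent {r : ℝ} (hr : 0 ≤ r) (hr1 : r < 1) {Q : PowerSeries ℤ_[p]}
    (hQ : PowerSeries.coeff 0 Q ≠ 0) (F : PowerSeries ℤ_[p]) :
    ∃ (v : PowerSeries ℤ_[p]) (G : convPS r), F + v * Q = toPadic p G := by
  set k := (PowerSeries.coeff 0 Q).valuation
  -- As `Q_0` is a unit times `p^k`, its multiples can move `a` to its residue in `[0, p^k)`, an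
  -- integer bounded independently of the degree.
  have hb (a : ℤ_[p]) : ∃ b, a + b * PowerSeries.coeff 0 Q = (a.appr k : ℤ_[p]) := by
    obtain ⟨b, hb⟩ := Ideal.mem_span_singleton.1 (PadicInt.appr_spec k a)
    refine ⟨-b * ((PadicInt.unitCoeff hQ)⁻¹ : ℤ_[p]ˣ), ?_⟩
    have h1 : PowerSeries.coeff 0 Q = PadicInt.unitCoeff hQ * (p : ℤ_[p]) ^ k :=
      PadicInt.unitCoeff_spec hQ
    have h2 := Units.inv_mul (PadicInt.unitCoeff hQ)
    linear_combination hb - b * ((PadicInt.unitCoeff hQ)⁻¹ : ℤ_[p]ˣ) * h1 - b * (p : ℤ_[p]) ^ k * h2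
  choose b hb using hb
  obtain ⟨v, hv⟩ := exists_coeff_recursion F Q fun _ a => b a
  choose a _ ha using hv
  refine ⟨v, ⟨PowerSeries.mk fun n => ((a n).appr k : ℤ), mem_convPS_of_bounded hr hr1
    (C := (p : ℝ) ^ k) fun n => ?_⟩, ?_⟩
  · rw [PowerSeries.coeff_mk, Int.cast_natCast, Nat.abs_cast]
    exact_mod_cast (PadicInt.appr_lt (a n) k).le
  · ext n
    rw [ha, hb, coeff_toPadic, PowerSeries.coeff_mk, Int.cast_natCast]

/-- Recursively, `p^k * q_n` is an integer. It is divisible by `p^k` in `ℤ_p`, hence in `ℤ`, so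
`q_n` is itself an integer. -/
theorem exists_toPadic_eq_of_mul_eq {F G : PowerSeries ℤ} {k : ℕ}
    (hG : PowerSeries.coeff 0 G = (p : ℤ) ^ k) {q : PowerSeries ℤ_[p]}
    (h : toPadic p F = toPadic p G * q) : ∃ H, toPadic p H = q := by
  have hmem : ∀ n, PowerSeries.coeff n q ∈ (Int.castRingHom ℤ_[p]).range := by
    intro n
    induction n using Nat.strong_induction_on with
    | _ n ih =>
      have h1 := congrArg (PowerSeries.coeff n) h
      rw [PowerSeries.coeff_mul, Finset.Nat.sum_antidiagonal_eq_sum_range_succ_mk,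
        Finset.sum_range_succ', coeff_toPadic, coeff_toPadic, hG, Nat.sub_zero] at h1
      have h2 : ∑ i ∈ Finset.range n, PowerSeries.coeff (i + 1) (toPadic p G) *
          PowerSeries.coeff (n - (i + 1)) q ∈ (Int.castRingHom ℤ_[p]).range := by
        refine Subring.sum_mem _ fun i hi => Subring.mul_mem _ ⟨PowerSeries.coeff (i + 1) G, ?_⟩
          (ih _ (by have := Finset.mem_range.1 hi; omega))
        rw [coeff_toPadic]
        rfl
      obtain ⟨z, hz⟩ := h2
      rw [← hz] at h1
      have h3 : (p : ℤ_[p]) ^ k * PowerSeries.coeff n q =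
          ((PowerSeries.coeff n F - z : ℤ) : ℤ_[p]) := by
        push_cast at h1 ⊢
        rw [h1, eq_intCast]
        ring
      obtain ⟨w, hw⟩ := (PadicInt.pow_p_dvd_int_iff k _).1 ⟨_, h3.symm⟩
      rw [hw] at h3
      push_cast at h3
      refine ⟨w, ?_⟩
      have hp : (p : ℤ_[p]) ^ k ≠ 0 := pow_ne_zero _ PadicInt.prime_p.ne_zero
      exact (mul_left_cancel₀ hp h3).symm
  choose a ha using hmem
  refine ⟨PowerSeries.mk a, ?_⟩
  ext n
  rw [coeff_toPadic, PowerSeries.coeff_mk, ← ha]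
  rfl

theorem multiset_prod_coeff_zero {r : ℝ} {s : Multiset (convPS r)}
    (hs : ∀ G ∈ s, IsComplexGenerator G) :
    PowerSeries.coeff 0 (s.prod : PowerSeries ℤ) = 1 := by
  induction s using Multiset.induction_on with
  | empty => simp
  | cons G s ih =>
    have h1 := (hs G (Multiset.mem_cons_self _ _)).1
    have h2 := ih fun H hH => hs H (Multiset.mem_cons_of_mem hH)
    rw [PowerSeries.coeff_zero_eq_constantCoeff_apply] at h1 h2 ⊢
    rw [Multiset.prod_cons, Subring.coe_mul, map_mul, h1, h2, one_mul]

/-- A power series without complex zeros in the disc which generates the kernel of evaluation at a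
`p`-adic point. -/
theorem exists_generator_padic {r : ℝ} (hr : 0 ≤ r) (hr1 : r < 1) {x : PadicAlgCl p} (hx0 : x ≠ 0)
    (hx : ‖x‖ < 1) : ∃ (G : convPS r) (k : ℕ), k ≠ 0 ∧
      PowerSeries.coeff 0 (G : PowerSeries ℤ) = (p : ℤ) ^ k ∧
      (∀ (y : PadicAlgCl p) (hy : ‖y‖ < 1),
        padicEval y hy (toPadic p G) = 0 ↔ Polynomial.aeval y (minpoly ℚ_[p] x) = 0) ∧
      ∀ F : convPS r, padicEval x hx (toPadic p F) = 0 → G ∣ F := by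
  obtain ⟨Q, hQ, hQd⟩ := exists_distinguished hx
  have hint : IsIntegral ℚ_[p] x := Algebra.IsIntegral.isIntegral x
  have hQ0 : Q.coeff 0 ≠ 0 := by
    intro h
    apply minpoly.coeff_zero_ne_zero hint hx0
    rw [← hQ, Polynomial.coeff_map, h, map_zero]
  have hQ0' : PowerSeries.coeff 0 (Q : PowerSeries ℤ_[p]) ≠ 0 := by rwa [Polynomial.coeff_coe]
  have hdeg : 0 < Q.natDegree := by
    rw [← hQd.monic.natDegree_map (algebraMap ℤ_[p] ℚ_[p]), hQ]
    exact minpoly.natDegree_pos hint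
  set k := (Q.coeff 0).valuation with hk
  have hspec := PadicInt.unitCoeff_spec hQ0
  rw [← hk] at hspec
  set ε := PadicInt.unitCoeff hQ0
  have hk0 : k ≠ 0 := by
    intro h0
    rw [h0, pow_zero, mul_one] at hspec
    exact (IsLocalRing.mem_maximalIdeal _).1 (hQd.mem hdeg) (hspec ▸ ε.isUnit)
  let F₀ : PowerSeries ℤ_[p] := PowerSeries.C (ε⁻¹ : ℤ_[p]ˣ).val * Q
  -- Only the part above degree `0` is corrected, so that the constant coefficient stays exactly
  -- `p^k` and the cofactor `u` keeps the unit constant coefficient `ε⁻¹`.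
  obtain ⟨v, G₁, hG₁⟩ := exists_integral_congruent hr hr1 hQ0'
    (PowerSeries.mk fun n => PowerSeries.coeff (n + 1) F₀)
  let Y : convPS r := ⟨PowerSeries.X ^ 1, X_pow_mem_convPS hr hr1 1⟩
  let G₂ : convPS r := (p : convPS r) ^ k + Y * G₁
  let u : PowerSeries ℤ_[p] := PowerSeries.C (ε⁻¹ : ℤ_[p]ˣ).val + PowerSeries.X * v
  have hu : IsUnit u := by
    rw [PowerSeries.isUnit_iff_constantCoeff]
    simp [u]
  have hF₀ : F₀ = (p : PowerSeries ℤ_[p]) ^ k +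
      PowerSeries.X * PowerSeries.mk fun n => PowerSeries.coeff (n + 1) F₀ := by
    have h1 := PowerSeries.sub_const_eq_X_mul_shift F₀
    have h2 : PowerSeries.constantCoeff F₀ = (p : ℤ_[p]) ^ k := by
      simp only [F₀, map_mul, PowerSeries.constantCoeff_C]
      rw [← PowerSeries.coeff_zero_eq_constantCoeff_apply, Polynomial.coeff_coe, hspec,
        Units.inv_mul_cancel_left]
    rw [h2, map_pow, map_natCast] at h1
    rw [← h1]
    ring
  have hG₂ : toPadic p G₂ = u * Q := by
    have h1 : toPadic p G₂ = (p : PowerSeries ℤ_[p]) ^ k + PowerSeries.X * toPadic p G₁ := by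
      simp only [G₂, Y, Subring.coe_add, Subring.coe_mul, Subring.coe_pow, Subring.coe_natCast,
        map_add, map_mul, map_pow, map_natCast, pow_one]
      simp [toPadic]
    rw [h1, ← hG₁, mul_add, ← add_assoc, ← hF₀]
    ring
  have hG₂0 : PowerSeries.coeff 0 (G₂ : PowerSeries ℤ) = (p : ℤ) ^ k := by
    simp [G₂, Y]
  have hp0 : (p : ℤ) ^ k ≠ 0 := pow_ne_zero _ (by exact_mod_cast (Fact.out : p.Prime).ne_zero)
  -- Complex zeros of `G₂` are divided out. The removed factors have constant coefficient `1`, so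
  -- over `ℤ_p` this changes `G₂` only by a unit.
  obtain ⟨s, hs, G, hG, hprod⟩ := exists_prod_mul_zeroFree hr hr1 (F := G₂) (by rwa [hG₂0])
  have hs1 := multiset_prod_coeff_zero hs
  have hsu : IsUnit (toPadic p s.prod) := by
    refine IsUnit.map _ (PowerSeries.isUnit_iff_constantCoeff.2 ?_)
    rw [← PowerSeries.coeff_zero_eq_constantCoeff_apply, hs1]
    exact isUnit_one
  obtain ⟨w, hw⟩ := hsu
  obtain ⟨u', hu'⟩ := hu
  have hGQ : toPadic p G = ((w⁻¹ * u' : (PowerSeries ℤ_[p])ˣ) : PowerSeries ℤ_[p]) * Q := by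
    rw [hprod, Subring.coe_mul, map_mul, ← hw, ← hu'] at hG₂
    rw [Units.val_mul, mul_assoc, ← hG₂, Units.inv_mul_cancel_left]
  have hG0 : PowerSeries.coeff 0 (G : PowerSeries ℤ) = (p : ℤ) ^ k := by
    rw [← hG₂0, hprod]
    rw [PowerSeries.coeff_zero_eq_constantCoeff_apply] at hs1 ⊢
    rw [PowerSeries.coeff_zero_eq_constantCoeff_apply, Subring.coe_mul, map_mul, hs1, one_mul]
  refine ⟨G, k, hk0, hG0, fun y hy => ?_, fun F hF => ?_⟩
  · rw [hGQ, map_mul, mul_eq_zero, or_iff_right (((Units.isUnit _).map _).ne_zero), padicEval_coe,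
      eval₂_padicCoe, hQ]
  · obtain ⟨q, hq⟩ := dvd_of_padicEval_eq_zero hx hQ hQd hF
    have h1 : toPadic p F = toPadic p G * (((w⁻¹ * u')⁻¹ : (PowerSeries ℤ_[p])ˣ) * q) := by
      have h2 := Units.mul_inv (w⁻¹ * u')
      rw [hGQ, hq]
      linear_combination -(Q * q : PowerSeries ℤ_[p]) * h2
    -- The quotient is integral because `G_0 = p^k`, and convergent because `G` is zero-free.
    obtain ⟨H, hH⟩ := exists_toPadic_eq_of_mul_eq hG0 h1
    have h2 : (F : PowerSeries ℤ) = G * H := by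
      apply toPadic_injective (p := p)
      rw [h1, map_mul, hH]
    exact ⟨⟨H, hG.mem_of_mul_eq hr h2⟩, Subtype.ext h2⟩

/-- A primitive integral power series with constant coefficient divisible by `p` has a `p`-adic
root. -/
theorem exists_padic_root {F : PowerSeries ℤ} (hF0 : PowerSeries.coeff 0 F ≠ 0)
    (hpF : (p : ℤ) ∣ PowerSeries.coeff 0 F) {n : ℕ} (hn : ¬ (p : ℤ) ∣ PowerSeries.coeff n F) :
    ∃ (x : PadicAlgCl p) (hx : ‖x‖ < 1), x ≠ 0 ∧ padicEval x hx (toPadic p F) = 0 := by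
  have hmem (a : ℤ) : (a : ℤ_[p]) ∈ IsLocalRing.maximalIdeal ℤ_[p] ↔ (p : ℤ) ∣ a := by
    rw [IsLocalRing.mem_maximalIdeal, PadicInt.mem_nonunits, PadicInt.norm_int_lt_one_iff_dvd]
  have hres : (toPadic p F).map (IsLocalRing.residue ℤ_[p]) ≠ 0 := by
    intro h
    have h1 := congrArg (PowerSeries.coeff n) h
    rw [PowerSeries.coeff_map, coeff_toPadic, map_zero, IsLocalRing.residue_eq_zero_iff, hmem] at h1
    exact hn h1
  obtain ⟨D, w, hD, hw, hDw⟩ := PowerSeries.exists_isWeierstrassFactorization hres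
  have h0 := congrArg PowerSeries.constantCoeff hDw
  rw [map_mul, ← PowerSeries.coeff_zero_eq_constantCoeff_apply (toPadic p F), coeff_toPadic,
    ← PowerSeries.coeff_zero_eq_constantCoeff_apply (D : PowerSeries ℤ_[p]),
    Polynomial.coeff_coe] at h0
  have hw0 : IsUnit (PowerSeries.constantCoeff w) := PowerSeries.isUnit_iff_constantCoeff.1 hw
  -- In degree `0` one has `D = 1`, and the constant coefficient of `F` would be a unit of `ℤ_p`.
  have hdeg : D.degree ≠ 0 := by
    intro hd
    have h1 : D = 1 := hD.monic.natDegree_eq_zero.1 (Polynomial.natDegree_eq_of_degree_eq_some hd)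
    rw [h1, Polynomial.coeff_one_zero, one_mul] at h0
    have h2 := (hmem _).2 hpF
    rw [h0] at h2
    exact (IsLocalRing.mem_maximalIdeal _).1 h2 hw0
  obtain ⟨x, hx⟩ := IsAlgClosed.exists_eval₂_eq_zero_of_injective (padicCoe p) padicCoe_injective
    D hdeg
  have hx1 := norm_lt_one_of_isRoot hD hx
  refine ⟨x, hx1, ?_, ?_⟩
  · rintro rfl
    rw [Polynomial.eval₂_at_zero, map_eq_zero_iff _ padicCoe_injective] at hx
    rw [hx, zero_mul] at h0
    exact hF0 (by exact_mod_cast h0)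
  · rw [hDw, map_mul, padicEval_coe, hx, zero_mul]

/-- Correction modulo `Q` puts `ℤ_p` in the image, which also contains `x` and `x⁻¹`. As `Q` is
distinguished, `Q(x) = 0` reads `x^d = -p * s` with `s` in the image, so `p⁻¹ = -s * x⁻¹ ^ d` lies
there too, and with it all of `ℚ_p`. -/
theorem ker_evalPadic_isMaximal {r : ℝ} (hr : 0 ≤ r) (hr1 : r < 1) {x : PadicAlgCl p} (hx0 : x ≠ 0)
    (hn : IsTopologicallyNilpotent x) :
    (RingHom.ker (evalPadic (r := r) x hx0 hn)).IsMaximal := by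
  set e := evalPadic (r := r) x hx0 hn
  have hx := norm_lt_one_of_isTopologicallyNilpotent hn
  obtain ⟨Q, hQ, hQd⟩ := exists_distinguished hx
  have hQx : Q.eval₂ (padicCoe p) x = 0 := by rw [eval₂_padicCoe, hQ, minpoly.aeval]
  have hint : IsIntegral ℚ_[p] x := Algebra.IsIntegral.isIntegral x
  have hQ0 : Q.coeff 0 ≠ 0 := by
    intro h
    apply minpoly.coeff_zero_ne_zero hint hx0
    rw [← hQ, Polynomial.coeff_map, h, map_zero]
  have hZ (c : ℤ_[p]) : padicCoe p c ∈ e.range := by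
    obtain ⟨v, G, hG⟩ := exists_integral_congruent hr hr1
      (Q := (Q : PowerSeries ℤ_[p])) (by rwa [Polynomial.coeff_coe]) (PowerSeries.C c)
    refine ⟨ofPS r G, ?_⟩
    rw [evalPadic_ofPS_eq, ← hG, map_add, map_mul, padicEval_coe, hQx, mul_zero, add_zero,
      padicEval_C]
  have hX : e (unitT r 1) = x := by
    have h1 := ofPS_X_pow (r := r) 1 (X_pow_mem_convPS hr hr1 1)
    rw [Nat.cast_one] at h1
    rw [← h1, evalPadic_ofPS_eq]
    have h2 : toPadic p (PowerSeries.X ^ 1) = ((Polynomial.X : Polynomial ℤ_[p]) :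
        PowerSeries ℤ_[p]) := by simp [toPadic]
    rw [h2, padicEval_coe, Polynomial.eval₂_X]
  have hXmem : x ∈ e.range := ⟨_, hX⟩
  have hXinv : x⁻¹ ∈ e.range := by
    refine ⟨((unitT r 1)⁻¹ : (convergentLaurent r)ˣ), ?_⟩
    refine eq_inv_of_mul_eq_one_left ?_
    have h1 := congrArg e (Units.inv_mul (unitT r 1))
    rwa [map_mul, hX, map_one] at h1
  have hpne : (p : PadicAlgCl p) ≠ 0 := by exact_mod_cast (Fact.out : p.Prime).ne_zero
  have hpinv : (p : PadicAlgCl p)⁻¹ ∈ e.range := by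
    have hdvd (i : ℕ) : ∃ b, i < Q.natDegree → Q.coeff i = p * b := by
      by_cases hi : i < Q.natDegree
      · have := hQd.mem hi
        rw [PadicInt.maximalIdeal_eq_span_p, Ideal.mem_span_singleton] at this
        exact this.imp fun b hb _ => hb
      · exact ⟨0, fun h => absurd h hi⟩
    choose b hb using hdvd
    rw [Polynomial.eval₂_eq_sum_range, Finset.sum_range_succ, hQd.monic.coeff_natDegree, map_one,
      one_mul] at hQx
    have h1 : ∑ i ∈ Finset.range Q.natDegree, padicCoe p (Q.coeff i) * x ^ i =
        p * ∑ i ∈ Finset.range Q.natDegree, padicCoe p (b i) * x ^ i := by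
      rw [Finset.mul_sum]
      refine Finset.sum_congr rfl fun i hi => ?_
      rw [hb i (Finset.mem_range.1 hi), map_mul, map_natCast, mul_assoc]
    rw [h1] at hQx
    have h2 : (p : PadicAlgCl p)⁻¹ = -(∑ i ∈ Finset.range Q.natDegree, padicCoe p (b i) * x ^ i) *
        x⁻¹ ^ Q.natDegree := by
      rw [inv_pow, eq_mul_inv_iff_mul_eq₀ (pow_ne_zero _ hx0), inv_mul_eq_iff_eq_mul₀ hpne]
      linear_combination hQx
    rw [h2]
    exact e.range.mul_mem (e.range.neg_mem (Subring.sum_mem _ fun i _ =>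
      e.range.mul_mem (hZ _) (e.range.pow_mem hXmem _))) (e.range.pow_mem hXinv _)
  refine ker_isMaximal_of_le_range (K := ℚ_[p]) e fun c => ?_
  obtain ⟨a, b, hb, rfl⟩ := IsFractionRing.div_surjective ℤ_[p] c
  have hb0 := nonZeroDivisors.ne_zero hb
  have h3 : algebraMap ℚ_[p] (PadicAlgCl p) (algebraMap ℤ_[p] ℚ_[p] a / algebraMap ℤ_[p] ℚ_[p] b) =
      padicCoe p (a * ((PadicInt.unitCoeff hb0)⁻¹ : ℤ_[p]ˣ)) * (p : PadicAlgCl p)⁻¹ ^ b.valuation := by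
    have h4 : padicCoe p b ≠ 0 := by rwa [Ne, map_eq_zero_iff _ padicCoe_injective]
    rw [map_div₀, ← padicCoe_apply, ← padicCoe_apply, div_eq_iff h4]
    have hs := congrArg (padicCoe p) (PadicInt.unitCoeff_spec hb0)
    rw [map_mul, map_pow, map_natCast] at hs
    rw [hs, inv_pow, map_mul]
    have h5 : padicCoe p ((PadicInt.unitCoeff hb0)⁻¹ : ℤ_[p]ˣ) *
        padicCoe p (PadicInt.unitCoeff hb0) = 1 := by
      rw [← map_mul, Units.inv_mul, map_one]
    have h6 := inv_mul_cancel₀ (pow_ne_zero b.valuation hpne)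
    linear_combination -(padicCoe p a) * h5 * ((p : PadicAlgCl p) ^ b.valuation)⁻¹ *
      (p : PadicAlgCl p) ^ b.valuation - padicCoe p a * h6
  rw [h3]
  exact e.range.mul_mem (hZ _) (e.range.pow_mem hpinv _)

end Padic

end ConvergentLaurent

namespace ConvergentLaurent

/-! ### Classification of the nonzero primes -/

variable {r : ℝ}

/-- The primes of `ℤ((T))_{>r}`: kernels of evaluations at complex numbers, primes `(p)`, and
kernels of evaluations at `p`-adic numbers. -/
def IsListed (P : Ideal (convergentLaurent r)) : Prop :=
  (∃ (x : ℂ) (hx : x ≠ 0) (hxr : ‖x‖ ≤ r), P = RingHom.ker (evalComplex x hx hxr)) ∨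
  (∃ p : ℕ, p.Prime ∧ P = Ideal.span {(p : convergentLaurent r)}) ∨
  (∃ (p : ℕ) (_ : Fact p.Prime) (x : PadicAlgCl p) (hx : x ≠ 0)
    (hn : IsTopologicallyNilpotent x), P = RingHom.ker (evalPadic x hx hn))

theorem exists_ker_evalComplex_eq_span (hr1 : r < 1) {x : ℂ} (hx : x ≠ 0) (hxr : ‖x‖ ≤ r) :
    ∃ G : convPS r, PowerSeries.coeff 0 (G : PowerSeries ℤ) = 1 ∧
      (∀ z, ‖z‖ ≤ r → (sumAt G z = 0 ↔ z = x ∨ z = starRingEnd ℂ x)) ∧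
      RingHom.ker (evalComplex x hx hxr) = Ideal.span {ofPS r G} := by
  obtain ⟨G, hG0, hG, hdiv⟩ := exists_generator_complex hr1 hx hxr
  refine ⟨G, hG0, hG, ker_eq_span _ ?_ fun F hF => hdiv F ?_⟩
  · rw [evalComplex_ofPS, (hG x hxr).2 (Or.inl rfl)]
  · rwa [evalComplex_ofPS] at hF

theorem exists_ker_evalPadic_eq_span (hr : 0 ≤ r) (hr1 : r < 1) {p : ℕ} [Fact p.Prime]
    {x : PadicAlgCl p} (hx : x ≠ 0) (hn : IsTopologicallyNilpotent x) :
    ∃ (G : convPS r) (k : ℕ), k ≠ 0 ∧ PowerSeries.coeff 0 (G : PowerSeries ℤ) = (p : ℤ) ^ k ∧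
      (∀ (y : PadicAlgCl p) (hy : ‖y‖ < 1),
        padicEval y hy (toPadic p G) = 0 ↔ Polynomial.aeval y (minpoly ℚ_[p] x) = 0) ∧
      RingHom.ker (evalPadic (r := r) x hx hn) = Ideal.span {ofPS r G} ∧
      ∀ F : convPS r, evalPadic x hx hn (ofPS r F) = 0 → G ∣ F := by
  have hx1 := norm_lt_one_of_isTopologicallyNilpotent hn
  obtain ⟨G, k, hk, hG0, hG, hdiv⟩ := exists_generator_padic hr hr1 hx hx1
  have hd (F : convPS r) (hF : evalPadic x hx hn (ofPS r F) = 0) : G ∣ F :=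
    hdiv F (by rwa [evalPadic_ofPS_eq] at hF)
  refine ⟨G, k, hk, hG0, hG, ker_eq_span _ ?_ hd, hd⟩
  rw [evalPadic_ofPS_eq, hG, minpoly.aeval]

theorem IsListed.isMaximal (hr : 0 ≤ r) (hr1 : r < 1) {P : Ideal (convergentLaurent r)}
    (hP : IsListed P) : P.IsMaximal := by
  rcases hP with ⟨x, hx, hxr, rfl⟩ | ⟨p, hp, rfl⟩ | ⟨p, hp, x, hx, hn, rfl⟩
  · exact ker_evalComplex_isMaximal hr1 hx hxr
  · exact span_prime_isMaximal hr hr1 hp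
  · exact ker_evalPadic_isMaximal hr hr1 hx hn

theorem IsListed.exists_generator (hr : 0 < r) (hr1 : r < 1) {P : Ideal (convergentLaurent r)}
    (hP : IsListed P) : ∃ a, a ≠ 0 ∧ P = Ideal.span {a} := by
  have hne {G : convPS r} (hG : PowerSeries.coeff 0 (G : PowerSeries ℤ) ≠ 0) : ofPS r G ≠ 0 := by
    rw [Ne, map_eq_zero_iff _ (ofPS_injective r)]
    rintro rfl
    simp at hG
  rcases hP with ⟨x, hx, hxr, rfl⟩ | ⟨p, hp, rfl⟩ | ⟨p, hp, x, hx, hn, rfl⟩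
  · obtain ⟨G, hG0, -, hG⟩ := exists_ker_evalComplex_eq_span hr1 hx hxr
    exact ⟨_, hne (by rw [hG0]; exact one_ne_zero), hG⟩
  · refine ⟨_, fun h => hp.ne_zero ?_, rfl⟩
    -- Evaluation at the complex number `r` shows that `p` is nonzero in the ring.
    have h1 := congrArg (evalComplex (r : ℂ) (by exact_mod_cast hr.ne')
      (by simp [abs_of_pos hr])) h
    rw [map_natCast, map_zero] at h1
    exact_mod_cast h1
  · obtain ⟨G, k, -, hG0, -, hG, -⟩ := exists_ker_evalPadic_eq_span hr.le hr1 hx hn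
    exact ⟨_, hne (by rw [hG0]; exact pow_ne_zero _ (by exact_mod_cast hp.out.ne_zero)), hG⟩

theorem ZeroFree.coeff_zero_ne_zero (hr : 0 ≤ r) {F : convPS r} (hF : ZeroFree F) :
    PowerSeries.coeff 0 (F : PowerSeries ℤ) ≠ 0 := by
  intro h
  apply hF 0 (by simpa using hr)
  rw [sumAt_zero, h, Int.cast_zero]

theorem ZeroFree.of_mul (hr : 0 ≤ r) {F G : convPS r} (h : ZeroFree (F * G)) : ZeroFree G := by
  intro z hz h0
  exact h z hz (by rw [sumAt_mul hr _ _ hz, h0, mul_zero])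

theorem natAbs_coeff_zero_lt (hr : 0 ≤ r) {G H : convPS r} (h : ZeroFree (G * H))
    (hG : (PowerSeries.coeff 0 (G : PowerSeries ℤ)).natAbs ≠ 1) :
    (PowerSeries.coeff 0 (H : PowerSeries ℤ)).natAbs <
      (PowerSeries.coeff 0 ((G * H : convPS r) : PowerSeries ℤ)).natAbs := by
  have h1 := h.coeff_zero_ne_zero hr
  rw [PowerSeries.coeff_zero_eq_constantCoeff_apply] at h1 hG ⊢
  rw [PowerSeries.coeff_zero_eq_constantCoeff_apply, Subring.coe_mul, map_mul, Int.natAbs_mul]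
  rw [Subring.coe_mul, map_mul] at h1
  have h2 := Int.natAbs_ne_zero.2 (left_ne_zero_of_mul h1)
  have h3 := Int.natAbs_ne_zero.2 (right_ne_zero_of_mul h1)
  exact lt_mul_of_one_lt_left (by omega) (by omega)

/-- Each step splits off `p` or the generator of a `p`-adic kernel. If that factor lies in `P`,
maximality identifies `P`; otherwise the cofactor lies in `P`, with a smaller constant coefficient.
-/
theorem isListed_of_zeroFree_mem (hr : 0 ≤ r) (hr1 : r < 1) {P : Ideal (convergentLaurent r)}
    (hP : P.IsPrime) {F : convPS r} (hF : ZeroFree F) (hFP : ofPS r F ∈ P) : IsListed P := by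
  induction hn : (PowerSeries.coeff 0 (F : PowerSeries ℤ)).natAbs using
    Nat.strong_induction_on generalizing F with
  | _ n ih =>
    subst hn
    rcases eq_or_ne (PowerSeries.coeff 0 (F : PowerSeries ℤ)).natAbs 1 with h1 | h1
    · have hu : IsUnit (F : PowerSeries ℤ) := by
        rw [PowerSeries.isUnit_iff_constantCoeff,
          ← PowerSeries.coeff_zero_eq_constantCoeff_apply]
        exact Int.isUnit_iff_natAbs_eq.2 h1
      obtain ⟨H, hH⟩ := hu.dvd (a := ((1 : convPS r) : PowerSeries ℤ))
      let H' : convPS r := ⟨H, hF.mem_of_mul_eq hr hH⟩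
      have h2 : F * H' = 1 := Subtype.ext hH.symm
      refine absurd ((Ideal.eq_top_iff_one P).2 ?_) hP.ne_top
      rw [← map_one (ofPS r), ← h2, map_mul]
      exact P.mul_mem_right _ hFP
    · obtain ⟨p, hp, hpF⟩ := Nat.exists_prime_and_dvd h1
      have := Fact.mk hp
      by_cases hall : ∀ n, (p : ℤ) ∣ PowerSeries.coeff n (F : PowerSeries ℤ)
      · obtain ⟨H, rfl⟩ := natCast_dvd_convPS hr hp.ne_zero hall
        rw [map_mul, map_natCast] at hFP
        rcases hP.mem_or_mem hFP with h | h
        · refine Or.inr (Or.inl ⟨p, hp, ?_⟩)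
          exact ((span_prime_isMaximal hr hr1 hp).eq_of_le hP.ne_top
            ((Ideal.span_singleton_le_iff_mem P).2 h)).symm
        · refine ih _ (natAbs_coeff_zero_lt hr hF ?_) (hF.of_mul hr) h rfl
          simpa using hp.one_lt.ne'
      · push Not at hall
        obtain ⟨n, hn⟩ := hall
        obtain ⟨x, hx1, hx, hxF⟩ := exists_padic_root (hF.coeff_zero_ne_zero hr)
          (Int.natCast_dvd.2 hpF) hn
        have hxn : IsTopologicallyNilpotent x := tendsto_pow_atTop_nhds_zero_of_norm_lt_one hx1
        obtain ⟨G, k, hk, hG0, -, hG, hdiv⟩ := exists_ker_evalPadic_eq_span hr hr1 hx hxn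
        obtain ⟨H, rfl⟩ := hdiv F (by rw [evalPadic_ofPS_eq, hxF])
        rw [map_mul] at hFP
        rcases hP.mem_or_mem hFP with h | h
        · refine Or.inr (Or.inr ⟨p, _, x, hx, hxn, ?_⟩)
          refine ((ker_evalPadic_isMaximal hr hr1 hx hxn).eq_of_le hP.ne_top ?_).symm
          rw [hG]
          exact (Ideal.span_singleton_le_iff_mem P).2 h
        · refine ih _ (natAbs_coeff_zero_lt hr hF ?_) (hF.of_mul hr) h rfl
          rw [hG0, Int.natAbs_pow, Int.natAbs_natCast]
          exact (Nat.one_lt_pow hk hp.one_lt).ne'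

theorem isListed_of_isPrime (hr : 0 ≤ r) (hr1 : r < 1) {P : Ideal (convergentLaurent r)}
    (hP0 : P ≠ ⊥) (hP : P.IsPrime) : IsListed P := by
  obtain ⟨f, hfP, hf0⟩ := Submodule.exists_mem_ne_zero_of_ne_bot hP0
  obtain ⟨m, F, hF0, rfl⟩ := exists_eq_unitT_mul hf0
  have hFP : ofPS r F ∈ P := (hP.mem_or_mem hfP).resolve_left fun h =>
    hP.ne_top (P.eq_top_of_isUnit_mem h (unitT r m).isUnit)
  obtain ⟨s, hs, H, hH, rfl⟩ := exists_prod_mul_zeroFree hr hr1 hF0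
  rw [map_mul, map_multiset_prod] at hFP
  rcases hP.mem_or_mem hFP with h | h
  · obtain ⟨a, ha, haP⟩ := (hP.multiset_prod_mem_iff_exists_mem _).1 h
    obtain ⟨G, hG, rfl⟩ := Multiset.mem_map.1 ha
    obtain ⟨-, x, hx, hxr, hker⟩ := hs G hG
    refine Or.inl ⟨x, hx, hxr, ?_⟩
    refine ((ker_evalComplex_isMaximal hr1 hx hxr).eq_of_le hP.ne_top ?_).symm
    rw [hker]
    exact (Ideal.span_singleton_le_iff_mem P).2 haP
  · exact isListed_of_zeroFree_mem hr hr1 hP hH h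

theorem isListed_iff (hr : 0 < r) (hr1 : r < 1) {P : Ideal (convergentLaurent r)} :
    (P ≠ ⊥ ∧ P.IsPrime) ↔ IsListed P := by
  refine ⟨fun h => isListed_of_isPrime hr.le hr1 h.1 h.2,
    fun h => ⟨?_, (h.isMaximal hr.le hr1).isPrime⟩⟩
  obtain ⟨a, ha, rfl⟩ := h.exists_generator hr hr1
  rwa [Ne, Ideal.span_singleton_eq_bot]

theorem isPrincipalIdealRing_convergentLaurent (hr : 0 < r) (hr1 : r < 1) :
    IsPrincipalIdealRing (convergentLaurent r) := by
  refine IsPrincipalIdealRing.of_prime_ne_bot fun P hP hP0 => ?_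
  obtain ⟨a, -, ha⟩ := ((isListed_iff hr hr1).1 ⟨hP0, hP⟩).exists_generator hr hr1
  exact ⟨a, ha⟩

/-! ### Coincidences between kernels -/

theorem ker_evalComplex_eq_iff (hr1 : r < 1) {x y : ℂ} (hx : x ≠ 0) (hxr : ‖x‖ ≤ r) (hy : y ≠ 0)
    (hyr : ‖y‖ ≤ r) : RingHom.ker (evalComplex x hx hxr) = RingHom.ker (evalComplex y hy hyr) ↔
      y = x ∨ y = starRingEnd ℂ x := by
  obtain ⟨G, -, hG, hker⟩ := exists_ker_evalComplex_eq_span hr1 hx hxr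
  constructor
  · intro h
    have h1 : ofPS r G ∈ RingHom.ker (evalComplex x hx hxr) := by
      rw [hker]
      exact Ideal.mem_span_singleton_self _
    rw [h, RingHom.mem_ker, evalComplex_ofPS] at h1
    exact (hG y hyr).1 h1
  · intro h
    refine (ker_evalComplex_isMaximal hr1 hx hxr).eq_of_le (RingHom.ker_ne_top _) ?_
    rw [hker, Ideal.span_singleton_le_iff_mem, RingHom.mem_ker, evalComplex_ofPS]
    exact (hG y hyr).2 h

/-- The norm is the spectral norm, hence invariant under `σ`; so `σ` is continuous and commutes with
the sum. -/
theorem evalPadic_algEquiv {p : ℕ} [Fact p.Prime] {x y : PadicAlgCl p} (hx : x ≠ 0)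
    (hxn : IsTopologicallyNilpotent x) (hy : y ≠ 0) (hyn : IsTopologicallyNilpotent y)
    (σ : PadicAlgCl p ≃ₐ[ℚ_[p]] PadicAlgCl p) (h : σ x = y) (f : convergentLaurent r) :
    evalPadic y hy hyn f = σ (evalPadic x hx hxn f) := by
  have hσ : Continuous σ := by
    refine (AddMonoidHomClass.isometry_of_norm σ fun z => ?_).continuous
    rw [← PadicAlgCl.spectralNorm_eq, ← PadicAlgCl.spectralNorm_eq]
    exact (spectralNorm_eq_of_equiv σ z).symm
  refine (hasSum_evalPadic y hy hyn f).unique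
    (((hasSum_evalPadic x hx hxn f).map σ hσ).congr_fun fun n => ?_)
  rw [Function.comp, map_mul, map_intCast, map_zpow₀, h]

theorem ker_evalPadic_eq_iff (hr : 0 ≤ r) (hr1 : r < 1) {p : ℕ} [Fact p.Prime]
    {x y : PadicAlgCl p} (hx : x ≠ 0) (hxn : IsTopologicallyNilpotent x) (hy : y ≠ 0)
    (hyn : IsTopologicallyNilpotent y) :
    RingHom.ker (evalPadic (r := r) x hx hxn) = RingHom.ker (evalPadic (r := r) y hy hyn) ↔
      ∃ σ : PadicAlgCl p ≃ₐ[ℚ_[p]] PadicAlgCl p, σ x = y := by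
  constructor
  · intro h
    obtain ⟨G, k, -, -, hG, hker, -⟩ := exists_ker_evalPadic_eq_span hr hr1 hx hxn
    have h1 : ofPS r G ∈ RingHom.ker (evalPadic (r := r) x hx hxn) := by
      rw [hker]
      exact Ideal.mem_span_singleton_self _
    rw [h, RingHom.mem_ker, evalPadic_ofPS_eq, hG] at h1
    exact (isConjRoot_of_aeval_eq_zero (Algebra.IsIntegral.isIntegral x) h1).symm.exists_algEquiv
  · rintro ⟨σ, h⟩
    ext f
    rw [RingHom.mem_ker, RingHom.mem_ker, evalPadic_algEquiv hx hxn hy hyn σ h,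
      map_eq_zero_iff σ σ.injective]

/-- The generator at `x` has constant coefficient `p^k`. For `q ≠ p` it is a unit in `ℤ_q⟦T⟧` and
cannot vanish at `y`. -/
theorem eq_of_ker_evalPadic_eq (hr : 0 ≤ r) (hr1 : r < 1) {p q : ℕ} [Fact p.Prime] [Fact q.Prime]
    {x : PadicAlgCl p} {y : PadicAlgCl q} (hx : x ≠ 0) (hxn : IsTopologicallyNilpotent x)
    (hy : y ≠ 0) (hyn : IsTopologicallyNilpotent y)
    (h : RingHom.ker (evalPadic (r := r) x hx hxn) = RingHom.ker (evalPadic (r := r) y hy hyn)) :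
    p = q := by
  obtain ⟨G, k, -, hG0, -, hker, -⟩ := exists_ker_evalPadic_eq_span hr hr1 hx hxn
  have h1 : ofPS r G ∈ RingHom.ker (evalPadic (r := r) x hx hxn) := by
    rw [hker]
    exact Ideal.mem_span_singleton_self _
  rw [h, RingHom.mem_ker, evalPadic_ofPS_eq] at h1
  by_contra hpq
  have hu : IsUnit (toPadic q G) := by
    rw [PowerSeries.isUnit_iff_constantCoeff, ← PowerSeries.coeff_zero_eq_constantCoeff_apply,
      coeff_toPadic, hG0, Int.cast_pow, Int.cast_natCast]
    refine IsUnit.pow _ (PadicInt.isUnit_iff.2 ?_)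
    rw [PadicInt.norm_natCast_eq_one_iff]
    exact (Nat.coprime_primes Fact.out Fact.out).2 (Ne.symm hpq)
  exact (hu.map _).ne_zero h1

end ConvergentLaurent

theorem mainTheorem5 (r : ℝ) (hr0 : 0 < r) (hr1 : r < 1) :
    (IsDomain (convergentLaurent r) ∧ IsPrincipalIdealRing (convergentLaurent r)) ∧
    (∀ P : Ideal (convergentLaurent r), (P ≠ ⊥ ∧ P.IsPrime) ↔
      ((∃ (x : ℂ) (hx : x ≠ 0) (hxr : ‖x‖ ≤ r), P = RingHom.ker (evalComplex x hx hxr)) ∨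
       (∃ p : ℕ, p.Prime ∧ P = Ideal.span {(p : convergentLaurent r)}) ∨
       (∃ (p : ℕ) (_ : Fact p.Prime) (x : PadicAlgCl p) (hx : x ≠ 0)
          (hn : IsTopologicallyNilpotent x), P = RingHom.ker (evalPadic x hx hn)))) ∧
    (∀ (x y : ℂ) (hx : x ≠ 0) (hxr : ‖x‖ ≤ r) (hy : y ≠ 0) (hyr : ‖y‖ ≤ r),
      RingHom.ker (evalComplex x hx hxr) = RingHom.ker (evalComplex y hy hyr) ↔
        y = x ∨ y = starRingEnd ℂ x) ∧
    (∀ (p : ℕ) [Fact p.Prime] (x y : PadicAlgCl p) (hx : x ≠ 0)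
      (hxn : IsTopologicallyNilpotent x) (hy : y ≠ 0) (hyn : IsTopologicallyNilpotent y),
      RingHom.ker (evalPadic (r := r) x hx hxn) = RingHom.ker (evalPadic (r := r) y hy hyn) ↔
        ∃ σ : PadicAlgCl p ≃ₐ[ℚ_[p]] PadicAlgCl p, σ x = y) ∧
    (∀ (p q : ℕ) [Fact p.Prime] [Fact q.Prime] (x : PadicAlgCl p) (y : PadicAlgCl q) (hx : x ≠ 0)
      (hxn : IsTopologicallyNilpotent x) (hy : y ≠ 0) (hyn : IsTopologicallyNilpotent y),
      RingHom.ker (evalPadic (r := r) x hx hxn) = RingHom.ker (evalPadic (r := r) y hy hyn) →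
        p = q) := by
  exact ⟨⟨inferInstance, isPrincipalIdealRing_convergentLaurent hr0 hr1⟩,
    fun P => isListed_iff hr0 hr1,
    fun x y hx hxr hy hyr => ker_evalComplex_eq_iff hr1 hx hxr hy hyr,
    fun p _ x y hx hxn hy hyn => ker_evalPadic_eq_iff hr0.le hr1 hx hxn hy hyn,
    fun p q _ _ x y hx hxn hy hyn => eq_of_ker_evalPadic_eq hr0.le hr1 hx hxn hy hyn⟩
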